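/- Let $M$ be a smooth real manifold and let $J$ be a smooth almost complex structure on $M$, i.e. a $(1,1)$-tensor field with $J^2=-\mathrm{Id}$. On the cotangent bundle $\pi:T^*M\to M$ let $\theta$ be the Liouville form, $\theta_\xi(U)=\xi(d\pi\,U)$, and let $\omega=d\theta$ be the canonical symplectic form. Let $\theta(J)$ be the one-form $\theta(J)_\xi(U)=\xi(J\,d\pi\,U)$, and let $J^c$ be the endomorphism field of $T(T^*M)$ defined by $d(\theta(J))=\omega(J^c\cdot,\cdot)$. For a tensor $R$ of type $(1,2)$ on $M$ let $\gamma(R)$ be the endomorphism field of $T(T^*M)$ defined by $\omega(\gamma(R)U,V)=\xi(R(d\pi\,U,d\pi\,V))$ for $U,V\in T_\xi T^*M$; in local coordinates, $\gamma(R)=p_kR^k_{i,j}\,dx^i\otimes\partial_{p_j}$. Let $N_J(X,Y)=[JX,JY]-J[X,JY]-J[JX,Y]-[X,Y]$, and define the complete lift $$\widetilde J=J^c-\tfrac12\gamma(JN_J).$$ For a connection $\nabla$ on $M$ with torsion $T(X,Y)=\nabla_XY-\nabla_YX-[X,Y]$ put $\widetilde\nabla=\nabla-\frac12T$, $(\widetilde\nabla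 J)(X,Y)=\widetilde\nabla_X(JY)-J\widetilde\nabla_XY$, $[\widetilde\nabla J](X,Y)=-(\widetilde\nabla J)(X,Y)+(\widetilde\nabla J)(Y,X)$, and define the horizontal lift $$J^{H,\nabla}=J^c+\gamma([\widetilde\nabla J]).$$ Let $a,b\in\mathbb R$ with $b\neq0$ and let $Z:T^*M\to T^*M$, $Z(x,p)=(x,\,ap+b\,p\circ J(x))$, be the fiberwise multiplication by $a+ib$. For an endomorphism field $A$ of $T(T^*M)$, say that $Z$ is $A$-holomorphic if $Z$ is smooth and $A(Z(\xi))\circ d_\xi Z=d_\xi Z\circ A(\xi)$ for every $\xi\in T^*M$. Then: (1) $Z$ is $\widetilde J$-holomorphic. (2) For every connection $\nabla$ on $M$, $Z$ is $J^{H,\nabla}$-holomorphic if and only if $(\widetilde\nabla J)(JX,Y)=(\widetilde\nabla J)(X,JY)$ for all $x\in M$ and $X,Y\in T_xM$. -/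

import Mathlib

open Bundle Set VectorField
open scoped Manifold ContDiff Topology

namespace AlmostComplex

noncomputable section

/-! ### One-forms and holomorphic maps on a general manifold -/

section General

variable {F : Type*} [NormedAddCommGroup F] [NormedSpace ℝ F]
  {H : Type*} [TopologicalSpace H] (I : ModelWithCorners ℝ F H)
  {N : Type*} [TopologicalSpace N] [ChartedSpace H N]

/-- The coordinate expression of the one-form `α` in the preferred chart `φ` at `y`: the one-form
`(φ⁻¹)^* α` on the model vector space. -/
def oneFormInChart (α : ∀ y : N, TangentSpace I y →L[ℝ] ℝ) (y : N) (z : F) : F →L[ℝ] ℝ :=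
  (α ((extChartAt I y).symm z)).comp (mfderiv 𝓘(ℝ, F) I (extChartAt I y).symm z)

/-- The exterior derivative of a one-form `α` on a manifold without boundary:
`dα (U, V) = ∂_U (α V) - ∂_V (α U)` in the preferred chart at `y`. -/
def extDerivOneForm [I.Boundaryless] (α : ∀ y : N, TangentSpace I y →L[ℝ] ℝ) (y : N) :
    TangentSpace I y →L[ℝ] TangentSpace I y →L[ℝ] ℝ :=
  let φ := extChartAt I y
  let D : F →L[ℝ] F →L[ℝ] ℝ := fderiv ℝ (oneFormInChart I α y) (φ y)
  let A : F →L[ℝ] F := mfderiv I 𝓘(ℝ, F) φ y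
  ContinuousLinearMap.bilinearComp (E' := F) (F' := F) (D - D.flip) A A

variable {F' : Type*} [NormedAddCommGroup F'] [NormedSpace ℝ F']
  {H' : Type*} [TopologicalSpace H'] (I' : ModelWithCorners ℝ F' H')
  {N' : Type*} [TopologicalSpace N'] [ChartedSpace H' N']

/-- A smooth map `f` is `(J, J')`-holomorphic if `J' (f y) ∘ d_y f = d_y f ∘ J y` for all `y`. -/
def IsHolomorphic (J : ∀ y : N, TangentSpace I y →L[ℝ] TangentSpace I y)
    (J' : ∀ y : N', TangentSpace I' y →L[ℝ] TangentSpace I' y) (f : N → N') : Prop :=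
  ContMDiff I I' ∞ f ∧
    ∀ y : N, (J' (f y)).comp (mfderiv I I' f y) = (mfderiv I I' f y).comp (J y)

end General

theorem extDerivOneForm_eq {F : Type*} [NormedAddCommGroup F] [NormedSpace ℝ F]
    {H : Type*} [TopologicalSpace H] (I : ModelWithCorners ℝ F H) [I.Boundaryless]
    {N : Type*} [TopologicalSpace N] [ChartedSpace H N] [IsManifold I 1 N]
    {α : ∀ y : N, TangentSpace I y →L[ℝ] ℝ} {y : N} {D : F →L[ℝ] F →L[ℝ] ℝ}
    (h : HasFDerivAt (oneFormInChart I α y) D (extChartAt I y y)) (U V : F) :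
    extDerivOneForm I α y U V = D U V - D V U := by
  have hA : (mfderiv I 𝓘(ℝ, F) (extChartAt I y) y : F →L[ℝ] F) = ContinuousLinearMap.id ℝ F :=
    mfderiv_extChartAt_self
  have e : extDerivOneForm I α y U V =
    fderiv ℝ (oneFormInChart I α y) (extChartAt I y y)
      ((mfderiv I 𝓘(ℝ, F) (extChartAt I y) y : F →L[ℝ] F) U)
      ((mfderiv I 𝓘(ℝ, F) (extChartAt I y) y : F →L[ℝ] F) V) -
    fderiv ℝ (oneFormInChart I α y) (extChartAt I y y)
      ((mfderiv I 𝓘(ℝ, F) (extChartAt I y) y : F →L[ℝ] F) V)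
      ((mfderiv I 𝓘(ℝ, F) (extChartAt I y) y : F →L[ℝ] F) U) := rfl
  rw [e, h.fderiv]
  erw [hA]
  rfl

theorem extDerivOneForm_eq_of_eventuallyEq {F : Type*} [NormedAddCommGroup F] [NormedSpace ℝ F]
    {H : Type*} [TopologicalSpace H] (I : ModelWithCorners ℝ F H) [I.Boundaryless]
    {N : Type*} [TopologicalSpace N] [ChartedSpace H N] [IsManifold I 1 N]
    {α : ∀ y : N, TangentSpace I y →L[ℝ] ℝ} {y : N} {D : F →L[ℝ] F →L[ℝ] ℝ}
    (h : oneFormInChart I α y =ᶠ[𝓝 (extChartAt I y y)] D) (U V : F) :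
    extDerivOneForm I α y U V = D U V - D V U :=
  extDerivOneForm_eq I (D.hasFDerivAt.congr_of_eventuallyEq h) U V

theorem isInvertible_of_nondegenerate {F : Type*} [NormedAddCommGroup F] [NormedSpace ℝ F]
    [FiniteDimensional ℝ F] (L : F →L[ℝ] F →L[ℝ] ℝ) (hL : ∀ U, (∀ V, L U V = 0) → U = 0) :
    L.IsInvertible := by
  have hinj : Function.Injective (L : F →ₗ[ℝ] F →L[ℝ] ℝ) := by
    rw [← LinearMap.ker_eq_bot, LinearMap.ker_eq_bot']
    exact fun U hU => hL U fun V => congrArg (fun A : F →L[ℝ] ℝ => A V) hU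
  have hdim : Module.finrank ℝ F = Module.finrank ℝ (F →L[ℝ] ℝ) := by
    rw [← (LinearMap.toContinuousLinearMap (𝕜 := ℝ) (E := F) (F' := ℝ)).finrank_eq]
    exact (Subspace.dual_finrank_eq (K := ℝ) (V := F)).symm
  exact ⟨(LinearEquiv.ofInjectiveOfFinrankEq (L : F →ₗ[ℝ] F →L[ℝ] ℝ) hinj
    hdim).toContinuousLinearEquiv, by ext U; rfl⟩

variable {E : Type*} [NormedAddCommGroup E] [NormedSpace ℝ E]
  {M : Type*} [TopologicalSpace M] [ChartedSpace E M] [IsManifold 𝓘(ℝ, E) ∞ M]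

variable (E M) in
/-- A (smooth) almost complex structure on `M`: a smooth `(1,1)`-tensor field `J`
with `J² = -Id`. -/
structure AlmostComplexStructure where
  /-- The endomorphism of each tangent space. -/
  toFun : ∀ x : M, TangentSpace 𝓘(ℝ, E) x →L[ℝ] TangentSpace 𝓘(ℝ, E) x
  contMDiff_toFun : ContMDiff 𝓘(ℝ, E) (𝓘(ℝ, E).prod 𝓘(ℝ, E →L[ℝ] E)) ∞
    (fun x => TotalSpace.mk' (E →L[ℝ] E)
      (E := fun x : M => TangentSpace 𝓘(ℝ, E) x →L[ℝ] TangentSpace 𝓘(ℝ, E) x) x (toFun x))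
  sq_eq_neg : ∀ (x : M) (X : TangentSpace 𝓘(ℝ, E) x), toFun x (toFun x X) = -X

instance : CoeFun (AlmostComplexStructure E M)
    (fun _ => ∀ x : M, TangentSpace 𝓘(ℝ, E) x →L[ℝ] TangentSpace 𝓘(ℝ, E) x) :=
  ⟨AlmostComplexStructure.toFun⟩

/-! ### The tensors `N_J` and `∇J` -/

/-- The vector field `J X`. -/
def AlmostComplexStructure.mulField (J : AlmostComplexStructure E M)
    (X : ∀ x : M, TangentSpace 𝓘(ℝ, E) x) : ∀ x : M, TangentSpace 𝓘(ℝ, E) x :=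
  fun x => J x (X x)

theorem AlmostComplexStructure.mdifferentiableAt_mulField (J : AlmostComplexStructure E M)
    {X : ∀ x : M, TangentSpace 𝓘(ℝ, E) x} {x : M} (hX : MDiffAt (T% X) x) :
    MDiffAt (T% (J.mulField X)) x :=
  MDifferentiableAt.clm_bundle_apply (b := fun x : M => x)
    (J.contMDiff_toFun.mdifferentiable (by simp) x) hX

theorem AlmostComplexStructure.mulField_add (J : AlmostComplexStructure E M)
    (X Y : ∀ x : M, TangentSpace 𝓘(ℝ, E) x) :
    J.mulField (X + Y) = J.mulField X + J.mulField Y := by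
  funext x
  simp [mulField]

theorem AlmostComplexStructure.mulField_smul (J : AlmostComplexStructure E M) (f : M → ℝ)
    (X : ∀ x : M, TangentSpace 𝓘(ℝ, E) x) :
    J.mulField (f • X) = f • J.mulField X := by
  funext x
  simp [mulField]

/-- `∇_X (J Y) - J ∇_X Y`, on vector fields `Y`, as a linear function of the vector `X`. -/
def nablaJAux (cov : CovariantDerivative 𝓘(ℝ, E) E (TangentSpace 𝓘(ℝ, E) : M → Type _))
    (J : AlmostComplexStructure E M) (Y : ∀ x : M, TangentSpace 𝓘(ℝ, E) x) (x : M) :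
    TangentSpace 𝓘(ℝ, E) x →L[ℝ] TangentSpace 𝓘(ℝ, E) x :=
  cov (J.mulField Y) x - (J x).comp (cov Y x)

theorem nablaJAux_tensorial
    (cov : CovariantDerivative 𝓘(ℝ, E) E (TangentSpace 𝓘(ℝ, E) : M → Type _))
    (J : AlmostComplexStructure E M) (x : M) :
    TensorialAt 𝓘(ℝ, E) E (fun Y => nablaJAux cov J Y x) x where
  smul hf hY := by
    have hcov := cov.isCovariantDerivativeOnUniv
    ext v
    simp [nablaJAux, J.mulField_smul, hcov.leibniz hY hf,
      hcov.leibniz (J.mdifferentiableAt_mulField hY) hf]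
    simp [AlmostComplexStructure.mulField]
    module
  add hY hY' := by
    have hcov := cov.isCovariantDerivativeOnUniv
    ext v
    simp [nablaJAux, J.mulField_add, hcov.add hY hY',
      hcov.add (J.mdifferentiableAt_mulField hY) (J.mdifferentiableAt_mulField hY')]
    module

/-! ### The cotangent bundle -/

variable (E M) in
/-- The cotangent bundle `T^*M`; its points are pairs `⟨x, p⟩` with `p` a covector at `x`. -/
abbrev CotangentBundle : Type _ :=
  TotalSpace (E →L[ℝ] ℝ) (fun x : M => TangentSpace 𝓘(ℝ, E) x →L[ℝ] ℝ)

variable (E) in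
/-- The model of the manifold `T^*M`. -/
abbrev cotangentModel : ModelWithCorners ℝ (E × (E →L[ℝ] ℝ)) (ModelProd E (E →L[ℝ] ℝ)) :=
  𝓘(ℝ, E).prod 𝓘(ℝ, E →L[ℝ] ℝ)

/-- The differential at `ξ` of the projection `π : T^*M → M`. -/
def dproj (ξ : CotangentBundle E M) :
    TangentSpace (cotangentModel E) ξ →L[ℝ] TangentSpace 𝓘(ℝ, E) ξ.proj :=
  mfderiv (cotangentModel E) 𝓘(ℝ, E) (fun η : CotangentBundle E M => η.proj) ξ

variable (E M) in
/-- The Liouville form `θ`: `θ_ξ (U) = ξ (dπ U)`. -/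
def liouville (ξ : CotangentBundle E M) : TangentSpace (cotangentModel E) ξ →L[ℝ] ℝ :=
  ξ.snd.comp (dproj ξ)

/-- The one-form `θ(J)`: `θ(J)_ξ (U) = ξ (J (dπ U))`. -/
def thetaJ (J : AlmostComplexStructure E M) (ξ : CotangentBundle E M) :
    TangentSpace (cotangentModel E) ξ →L[ℝ] ℝ :=
  ξ.snd.comp ((J ξ.proj).comp (dproj ξ))

/-- The two-form `θ(R)` for a `(1,2)`-tensor `R`: `θ(R)_ξ (U, V) = ξ (R (dπ U, dπ V))`. -/
def thetaTensor
    (R : ∀ x : M, TangentSpace 𝓘(ℝ, E) x →L[ℝ] TangentSpace 𝓘(ℝ, E) x →L[ℝ] TangentSpace 𝓘(ℝ, E) x)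
    (ξ : CotangentBundle E M) :
    TangentSpace (cotangentModel E) ξ →L[ℝ] TangentSpace (cotangentModel E) ξ →L[ℝ] ℝ :=
  let P : E × (E →L[ℝ] ℝ) →L[ℝ] E := dproj ξ
  let B : E →L[ℝ] E →L[ℝ] ℝ := (ContinuousLinearMap.compL ℝ E E ℝ ξ.snd).comp (R ξ.proj)
  ContinuousLinearMap.bilinearComp (E' := E × (E →L[ℝ] ℝ)) (F' := E × (E →L[ℝ] ℝ)) B P P

variable (E M) in
/-- The canonical symplectic form `ω = dθ` of `T^*M`, as the map `U ↦ ω (U, ·)`. -/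
def canonicalForm (ξ : CotangentBundle E M) :
    TangentSpace (cotangentModel E) ξ →L[ℝ] TangentSpace (cotangentModel E) ξ →L[ℝ] ℝ :=
  extDerivOneForm (cotangentModel E) (liouville E M) ξ

theorem oneFormInChart_liouville (ξ : CotangentBundle E M) {z : E × (E →L[ℝ] ℝ)}
    (hz : z ∈ (extChartAt (cotangentModel E) ξ).target) (U : E × (E →L[ℝ] ℝ)) :
    oneFormInChart (cotangentModel E) (liouville E M) ξ z U = z.2 U.1 := by
  set φ := extChartAt (cotangentModel E) ξ with hφ
  set ψ := extChartAt 𝓘(ℝ, E) ξ.proj with hψ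
  have hsym : MDifferentiableAt 𝓘(ℝ, E × (E →L[ℝ] ℝ)) (cotangentModel E) φ.symm z := by
    have := mdifferentiableWithinAt_extChartAt_symm (I := cotangentModel E) hz
    rwa [ModelWithCorners.range_eq_univ, mdifferentiableWithinAt_univ] at this
  have hpm : ContMDiff (cotangentModel E) 𝓘(ℝ, E) 1
      (fun η : CotangentBundle E M => η.proj) :=
    Bundle.contMDiff_proj (fun x : M => TangentSpace 𝓘(ℝ, E) x →L[ℝ] ℝ)
  have hp := hpm.mdifferentiable one_ne_zero (φ.symm z)
  have hzψ : z.1 ∈ ψ.target := by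
    have h := hz
    rw [hφ, FiberBundle.extChartAt_target] at h
    exact h.1.1
  have hsymψ : MDifferentiableAt 𝓘(ℝ, E) 𝓘(ℝ, E) ψ.symm z.1 := by
    have := mdifferentiableWithinAt_extChartAt_symm (I := 𝓘(ℝ, E)) hzψ
    rwa [ModelWithCorners.range_eq_univ, mdifferentiableWithinAt_univ] at this
  have hproj : ∀ w ∈ φ.target, (φ.symm w).proj = ψ.symm w.1 := by
    intro w hw
    have h := hw
    rw [hφ, FiberBundle.extChartAt_target] at h
    rw [hφ, FiberBundle.extChartAt]
    exact Trivialization.proj_symm_apply' (trivializationAt (E →L[ℝ] ℝ)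
      (fun x : M => TangentSpace 𝓘(ℝ, E) x →L[ℝ] ℝ) ξ.proj) h.1.2
  have hopen : IsOpen φ.target := isOpen_extChartAt_target ξ
  have hcomp : (fun w => (φ.symm w).proj) =ᶠ[𝓝 z] (fun w => ψ.symm w.1) := by
    filter_upwards [hopen.mem_nhds hz] with w hw using hproj w hw
  have hd : HasMFDerivAt 𝓘(ℝ, E × (E →L[ℝ] ℝ)) 𝓘(ℝ, E) (fun w => (φ.symm w).proj) z
      ((dproj (φ.symm z)).comp (mfderiv 𝓘(ℝ, E × (E →L[ℝ] ℝ)) (cotangentModel E) φ.symm z)) :=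
    HasMFDerivAt.comp (g := fun η : CotangentBundle E M => η.proj) z hp.hasMFDerivAt hsym.hasMFDerivAt
  have hd2 : HasMFDerivAt 𝓘(ℝ, E × (E →L[ℝ] ℝ)) 𝓘(ℝ, E) (fun w : E × (E →L[ℝ] ℝ) => ψ.symm w.1) z
      ((mfderiv 𝓘(ℝ, E) 𝓘(ℝ, E) ψ.symm z.1).comp (ContinuousLinearMap.fst ℝ E (E →L[ℝ] ℝ))) := by
    refine HasMFDerivAt.comp (g := ψ.symm) (f := fun w : E × (E →L[ℝ] ℝ) => w.1) z
      hsymψ.hasMFDerivAt ?_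
    exact (ContinuousLinearMap.fst ℝ E (E →L[ℝ] ℝ)).hasFDerivAt.hasMFDerivAt
  have hd3 := hasMFDerivAt_unique (hd2.congr_of_eventuallyEq hcomp) hd
  have hη : φ.symm z ∈ φ.source := φ.map_target hz
  have hηz : φ (φ.symm z) = z := φ.right_inv hz
  have hzψ' : ψ.symm z.1 ∈ (chartAt E ξ.proj).source := by
    have := ψ.map_target hzψ
    rwa [hψ, extChartAt_source] at this
  have hproj' : (φ.symm z).proj ∈ (chartAt E ξ.proj).source := by
    rw [hproj z hz]; exact hzψ'
  have h2 : z.2 U.1 = (φ.symm z).snd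
      ((trivializationAt E (TangentSpace 𝓘(ℝ, E) : M → Type _) ξ.proj).symmL ℝ (φ.symm z).proj U.1) := by
    conv_lhs => rw [← hηz]
    rw [hφ, FiberBundle.extChartAt]
    change ContinuousLinearMap.inCoordinates E (TangentSpace 𝓘(ℝ, E) : M → Type _) ℝ
      (fun _ : M => ℝ) ξ.proj (φ.symm z).proj ξ.proj (φ.symm z).proj (φ.symm z).snd U.1 = _
    unfold ContinuousLinearMap.inCoordinates
    rw [ContinuousLinearMap.comp_apply, ContinuousLinearMap.comp_apply]
    exact congrArg (fun L : ℝ →ₗ[ℝ] ℝ => L _)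
      (Bundle.Trivial.linearMapAt_trivialization ℝ M ℝ (φ.symm z).proj)
  rw [h2, TangentBundle.symmL_trivializationAt hproj']
  have h3 : extChartAt 𝓘(ℝ, E) ξ.proj (φ.symm z).proj = z.1 := by
    rw [hproj z hz]; exact ψ.right_inv hzψ
  rw [h3, ModelWithCorners.range_eq_univ, mfderivWithin_univ]
  have h4 := congrArg (fun L : E × (E →L[ℝ] ℝ) →L[ℝ] E => L U) hd3
  exact congrArg (fun v : E => (φ.symm z).snd v) h4.symm

/-- The canonical form in coordinates, `ω = dp_i ∧ dx^i`. -/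
theorem canonicalForm_apply (ξ : CotangentBundle E M) (U V : E × (E →L[ℝ] ℝ)) :
    canonicalForm E M ξ U V = U.2 V.1 - V.2 U.1 := by
  have hz := mem_extChartAt_target (I := cotangentModel E) ξ
  let D₀ : E × (E →L[ℝ] ℝ) →L[ℝ] E × (E →L[ℝ] ℝ) →L[ℝ] ℝ :=
    (ContinuousLinearMap.precomp ℝ (ContinuousLinearMap.fst ℝ E (E →L[ℝ] ℝ))).comp
      (ContinuousLinearMap.snd ℝ E (E →L[ℝ] ℝ))
  have hev : oneFormInChart (cotangentModel E) (liouville E M) ξ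
      =ᶠ[𝓝 (extChartAt (cotangentModel E) ξ ξ)] D₀ := by
    filter_upwards [(isOpen_extChartAt_target ξ).mem_nhds hz] with z hz
    refine ContinuousLinearMap.ext fun U => ?_
    rw [oneFormInChart_liouville ξ hz]
    rfl
  exact extDerivOneForm_eq_of_eventuallyEq (cotangentModel E) hev U V

/-- The canonical symplectic form is nondegenerate. -/
theorem canonicalForm_isInvertible [FiniteDimensional ℝ E] (ξ : CotangentBundle E M) :
    (canonicalForm E M ξ).IsInvertible := by
  refine isInvertible_of_nondegenerate (F := E × (E →L[ℝ] ℝ)) (canonicalForm E M ξ) fun U h => ?_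
  have h' : ∀ V : E × (E →L[ℝ] ℝ), U.2 V.1 - V.2 U.1 = 0 := fun V => by
    rw [← canonicalForm_apply ξ U V]
    exact h V
  refine Prod.ext ?_ ?_
  · by_contra hne
    obtain ⟨f, hf⟩ := SeparatingDual.exists_ne_zero (R := ℝ) hne
    have := h' (0, f)
    simp at this
    exact hf this
  · ext v
    simpa using h' (v, 0)

/-- For a bilinear form `β` on the tangent spaces of `T^*M`, the endomorphism field `A` given by
`β (U, V) = ω (A U, V)`. -/
def sharpForm
    (β : ∀ ξ : CotangentBundle E M,
      TangentSpace (cotangentModel E) ξ →L[ℝ] TangentSpace (cotangentModel E) ξ →L[ℝ] ℝ)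
    (ξ : CotangentBundle E M) :
    TangentSpace (cotangentModel E) ξ →L[ℝ] TangentSpace (cotangentModel E) ξ :=
  (canonicalForm E M ξ).inverse.comp (β ξ)

/-- The endomorphism `sharpForm β` satisfies `ω (sharpForm β U, V) = β (U, V)`. -/
theorem canonicalForm_sharpForm [FiniteDimensional ℝ E]
    (β : ∀ ξ : CotangentBundle E M,
      TangentSpace (cotangentModel E) ξ →L[ℝ] TangentSpace (cotangentModel E) ξ →L[ℝ] ℝ)
    (ξ : CotangentBundle E M) (U V : TangentSpace (cotangentModel E) ξ) :
    canonicalForm E M ξ (sharpForm β ξ U) V = β ξ U V := by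
  obtain ⟨e, he⟩ := canonicalForm_isInvertible ξ
  unfold sharpForm
  rw [← he, ContinuousLinearMap.inverse_equiv]
  exact congrArg (fun A : TangentSpace (cotangentModel E) ξ →L[ℝ] ℝ => A V)
    (e.apply_symm_apply (β ξ U))

/-- The lift `J^c`, given by `d(θ(J)) = ω (J^c ·, ·)`. -/
def liftC (J : AlmostComplexStructure E M) (ξ : CotangentBundle E M) :
    TangentSpace (cotangentModel E) ξ →L[ℝ] TangentSpace (cotangentModel E) ξ :=
  sharpForm (extDerivOneForm (cotangentModel E) (thetaJ J)) ξ

/-- The contraction `γ(R)` of a `(1,2)`-tensor `R`, given by `θ(R) = ω (γ(R) ·, ·)`; in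
coordinates `γ(R) = p_k R_{ij}^k dx^i ⊗ ∂p_j`. -/
def contraction
    (R : ∀ x : M, TangentSpace 𝓘(ℝ, E) x →L[ℝ] TangentSpace 𝓘(ℝ, E) x →L[ℝ] TangentSpace 𝓘(ℝ, E) x)
    (ξ : CotangentBundle E M) :
    TangentSpace (cotangentModel E) ξ →L[ℝ] TangentSpace (cotangentModel E) ξ :=
  sharpForm (thetaTensor R) ξ

/-! ### Tensor fields on the base and the lifts they define -/

variable [FiniteDimensional ℝ E]

/-- The tensor `(X, Y) ↦ B(Y, X)`. -/
def swapArgs {x : M}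
    (B : TangentSpace 𝓘(ℝ, E) x →L[ℝ] TangentSpace 𝓘(ℝ, E) x →L[ℝ] TangentSpace 𝓘(ℝ, E) x) :
    TangentSpace 𝓘(ℝ, E) x →L[ℝ] TangentSpace 𝓘(ℝ, E) x →L[ℝ] TangentSpace 𝓘(ℝ, E) x :=
  ContinuousLinearMap.flip (E := E) (F := E) (G := E) B

/-- The tensor `∇J`, `(∇J)(X, Y) = ∇_X (J Y) - J ∇_X Y`. -/
def nablaJ (cov : CovariantDerivative 𝓘(ℝ, E) E (TangentSpace 𝓘(ℝ, E) : M → Type _))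
    (J : AlmostComplexStructure E M) (x : M) :
    TangentSpace 𝓘(ℝ, E) x →L[ℝ] TangentSpace 𝓘(ℝ, E) x →L[ℝ] TangentSpace 𝓘(ℝ, E) x :=
  swapArgs (TensorialAt.mkHom (fun Y => nablaJAux cov J Y x) x (nablaJAux_tensorial cov J x))

/-- The symmetrised connection `∇̃ = ∇ - (1/2) T`, where `T` is the torsion of `∇`. -/
def symmetrize (cov : CovariantDerivative 𝓘(ℝ, E) E (TangentSpace 𝓘(ℝ, E) : M → Type _)) :
    CovariantDerivative 𝓘(ℝ, E) E (TangentSpace 𝓘(ℝ, E) : M → Type _) :=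
  cov.addOneForm (fun x => -((1 / 2 : ℝ) • swapArgs (cov.torsion x)))

/-- The tensor `[∇J](X, Y) = -(∇J)(X, Y) + (∇J)(Y, X)`. -/
def bracketNablaJ (cov : CovariantDerivative 𝓘(ℝ, E) E (TangentSpace 𝓘(ℝ, E) : M → Type _))
    (J : AlmostComplexStructure E M) (x : M) :
    TangentSpace 𝓘(ℝ, E) x →L[ℝ] TangentSpace 𝓘(ℝ, E) x →L[ℝ] TangentSpace 𝓘(ℝ, E) x :=
  -nablaJ cov J x + swapArgs (nablaJ cov J x)

/-- `[JX, JY] - J[X, JY] - J[JX, Y] - [X, Y]`, on vector fields. -/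
def nijenhuisAux (J : AlmostComplexStructure E M) (X Y : ∀ x : M, TangentSpace 𝓘(ℝ, E) x) (x : M) :
    TangentSpace 𝓘(ℝ, E) x :=
  mlieBracket 𝓘(ℝ, E) (J.mulField X) (J.mulField Y) x
    - J x (mlieBracket 𝓘(ℝ, E) X (J.mulField Y) x)
    - J x (mlieBracket 𝓘(ℝ, E) (J.mulField X) Y x)
    - mlieBracket 𝓘(ℝ, E) X Y x

theorem nijenhuisAux_tensorial_left (J : AlmostComplexStructure E M) (x : M)
    (Y : ∀ x : M, TangentSpace 𝓘(ℝ, E) x) :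
    TensorialAt 𝓘(ℝ, E) E (fun X => nijenhuisAux J X Y x) x where
  smul hf hX := by
    simp only [nijenhuisAux, J.mulField_smul, mlieBracket_smul_left hf hX,
      mlieBracket_smul_left hf (J.mdifferentiableAt_mulField hX), map_add, map_smul]
    simp only [AlmostComplexStructure.mulField, J.sq_eq_neg]
    module
  add hX hX' := by
    simp only [nijenhuisAux, J.mulField_add, mlieBracket_add_left hX hX',
      mlieBracket_add_left (J.mdifferentiableAt_mulField hX) (J.mdifferentiableAt_mulField hX'),
      map_add]
    module

theorem nijenhuisAux_tensorial_right (J : AlmostComplexStructure E M) (x : M)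
    (X : ∀ x : M, TangentSpace 𝓘(ℝ, E) x) :
    TensorialAt 𝓘(ℝ, E) E (fun Y => nijenhuisAux J X Y x) x where
  smul hf hY := by
    simp only [nijenhuisAux, J.mulField_smul, mlieBracket_smul_right hf hY,
      mlieBracket_smul_right hf (J.mdifferentiableAt_mulField hY), map_add, map_smul]
    simp only [AlmostComplexStructure.mulField, J.sq_eq_neg]
    module
  add hY hY' := by
    simp only [nijenhuisAux, J.mulField_add, mlieBracket_add_right hY hY',
      mlieBracket_add_right (J.mdifferentiableAt_mulField hY) (J.mdifferentiableAt_mulField hY'),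
      map_add]
    module

/-- The Nijenhuis tensor `N_J(X, Y) = [JX, JY] - J[X, JY] - J[JX, Y] - [X, Y]`. -/
def nijenhuis (J : AlmostComplexStructure E M) (x : M) :
    TangentSpace 𝓘(ℝ, E) x →L[ℝ] TangentSpace 𝓘(ℝ, E) x →L[ℝ] TangentSpace 𝓘(ℝ, E) x :=
  TensorialAt.mkHom₂ (fun X Y => nijenhuisAux J X Y x) x
    (fun Y _ => nijenhuisAux_tensorial_left J x Y)
    (fun X _ => nijenhuisAux_tensorial_right J x X)

/-- The tensor `J N_J`. -/
def mulNijenhuis (J : AlmostComplexStructure E M) (x : M) :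
    TangentSpace 𝓘(ℝ, E) x →L[ℝ] TangentSpace 𝓘(ℝ, E) x →L[ℝ] TangentSpace 𝓘(ℝ, E) x :=
  (ContinuousLinearMap.compL ℝ E E E (J x)).comp (nijenhuis J x)

/-- The complete lift `J̃ = J^c - (1/2) γ(J N_J)`. -/
def completeLift (J : AlmostComplexStructure E M) (ξ : CotangentBundle E M) :
    TangentSpace (cotangentModel E) ξ →L[ℝ] TangentSpace (cotangentModel E) ξ :=
  liftC J ξ - (1 / 2 : ℝ) • contraction (mulNijenhuis J) ξ

/-- The horizontal lift `J^{H,∇} = J^c + γ([∇̃J])`. -/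
def horizontalLift (cov : CovariantDerivative 𝓘(ℝ, E) E (TangentSpace 𝓘(ℝ, E) : M → Type _))
    (J : AlmostComplexStructure E M) (ξ : CotangentBundle E M) :
    TangentSpace (cotangentModel E) ξ →L[ℝ] TangentSpace (cotangentModel E) ξ :=
  liftC J ξ + contraction (bracketNablaJ (symmetrize cov) J) ξ

/-- The fiberwise multiplication by `a + i b` on `T^*M`: `Z (x, p) = (x, a p + b ᵗJ p)`. -/
def fiberMul (J : AlmostComplexStructure E M) (a b : ℝ) (ξ : CotangentBundle E M) :
    CotangentBundle E M :=
  ⟨ξ.proj, a • ξ.snd + b • ξ.snd.comp (J ξ.proj)⟩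

end

end AlmostComplex

/-!
On one-forms the map `Z` acts by `Z^*θ = a θ + b θ(J)` and `Z^*θ(J) = a θ(J) - b θ`. Taking
exterior derivatives and using `dθ(J) = ω(J^c ·, ·)`, one finds
`ω(dZ U, dZ V) = a ω(U, V) + b ω(J^c U, V)` and
`ω(J^c dZ U, dZ V) = a ω(J^c U, V) - b ω(U, V)`. Since `J^c` is `ω`-symmetric and
`(J^c)² = -1 + γ(N_J)`, testing `A ∘ dZ = dZ ∘ A` for `A = J^c + γ(R)` against `ω(·, dZ V)` leaves
`b ξ(J R(X, Y) - R(X, JY) - N_J(X, Y)) = 0`, where `X` and `Y` are the projections of `U` and `V`.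
For both lifts this is then a pointwise computation with `N_J`, which a torsion-free connection
expresses through `∇J`; the partial derivatives in a chart serve as such a connection at a point.
-/

namespace AlmostComplex

noncomputable section

section Pullback

variable {F : Type*} [NormedAddCommGroup F] [NormedSpace ℝ F]
  {H : Type*} [TopologicalSpace H] (I : ModelWithCorners ℝ F H)
  {N : Type*} [TopologicalSpace N] [ChartedSpace H N]
  {F' : Type*} [NormedAddCommGroup F'] [NormedSpace ℝ F']
  {H' : Type*} [TopologicalSpace H'] (I' : ModelWithCorners ℝ F' H')
  {N' : Type*} [TopologicalSpace N'] [ChartedSpace H' N']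

/-- The pullback `f^* α` of a one-form `α` along a map `f`, `(f^* α) (U) = α (df U)`. -/
def pullbackOneForm (f : N → N') (α : ∀ y : N', TangentSpace I' y →L[ℝ] ℝ) (y : N) :
    TangentSpace I y →L[ℝ] ℝ :=
  (α (f y)).comp (mfderiv I I' f y)

variable {I I'}
  {F'' : Type*} [NormedAddCommGroup F''] [NormedSpace ℝ F'']
  {H'' : Type*} [TopologicalSpace H''] {I'' : ModelWithCorners ℝ F'' H''}
  {N'' : Type*} [TopologicalSpace N''] [ChartedSpace H'' N'']

theorem pullbackOneForm_congr {f g : N → N'} {y : N} (h : f =ᶠ[𝓝 y] g)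
    (α : ∀ y : N', TangentSpace I' y →L[ℝ] ℝ) :
    pullbackOneForm I I' f α y = pullbackOneForm I I' g α y := by
  have hd : (mfderiv I I' f y : F →L[ℝ] F') = mfderiv I I' g y := h.mfderiv_eq
  exact congrArg₂ (fun (w : N') (L : F →L[ℝ] F') => ContinuousLinearMap.comp (α w : F' →L[ℝ] ℝ) L)
    h.eq_of_nhds hd

theorem pullbackOneForm_comp {f : N → N'} {g : N' → N''} {y : N}
    (hg : MDifferentiableAt I' I'' g (f y)) (hf : MDifferentiableAt I I' f y)
    (α : ∀ y : N'', TangentSpace I'' y →L[ℝ] ℝ) :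
    pullbackOneForm I I'' (g ∘ f) α y =
      pullbackOneForm I I' f (pullbackOneForm I' I'' g α) y :=
  congrArg (ContinuousLinearMap.comp (α (g (f y)))) (mfderiv_comp y hg hf)

theorem mdifferentiableAt_extChartAt_symm [I.Boundaryless] [IsManifold I 1 N] {y : N} {z : F}
    (hz : z ∈ (extChartAt I y).target) :
    MDifferentiableAt 𝓘(ℝ, F) I (extChartAt I y).symm z := by
  rw [← mdifferentiableWithinAt_univ, ← I.range_eq_univ]
  exact mdifferentiableWithinAt_extChartAt_symm hz

theorem oneFormInChart_pullbackOneForm [I.Boundaryless] [IsManifold I 1 N] [I'.Boundaryless]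
    [IsManifold I' 1 N'] {f : N → N'} {y : N} (hf : ∀ᶠ w in 𝓝 y, MDifferentiableAt I I' f w)
    (α : ∀ y : N', TangentSpace I' y →L[ℝ] ℝ) :
    oneFormInChart I (pullbackOneForm I I' f α) y =ᶠ[𝓝 (extChartAt I y y)] fun z =>
      (oneFormInChart I' α (f y) (writtenInExtChartAt I I' y f z)).comp
        (fderiv ℝ (writtenInExtChartAt I I' y f) z) := by
  have hφ := extChartAt_target_mem_nhds (I := I) y
  have hφc : Filter.Tendsto (extChartAt I y).symm (𝓝 (extChartAt I y y)) (𝓝 y) := by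
    simpa only [ContinuousAt, extChartAt_to_inv] using continuousAt_extChartAt_symm (I := I) y
  have hφ' : ∀ᶠ w in 𝓝 y, f w ∈ (extChartAt I' (f y)).source :=
    hf.self_of_nhds.continuousAt.eventually_mem (extChartAt_source_mem_nhds (f y))
  filter_upwards [hφ, hφc.eventually hf, (hφc.eventually hφ').eventually_nhds] with z hz hfz hz'
  have hsymm := mdifferentiableAt_extChartAt_symm hz
  have hchart := mdifferentiableAt_extChartAt (I := I')
    (by simpa only [extChartAt_source] using hz'.self_of_nhds)
  have hg : MDifferentiableAt 𝓘(ℝ, F) 𝓘(ℝ, F') (writtenInExtChartAt I I' y f) z :=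
    hchart.comp z (hfz.comp z hsymm)
  have hsymm' := mdifferentiableAt_extChartAt_symm (I := I')
    ((extChartAt I' (f y)).map_source hz'.self_of_nhds)
  have hcomp : f ∘ (extChartAt I y).symm =ᶠ[𝓝 z]
      (extChartAt I' (f y)).symm ∘ writtenInExtChartAt I I' y f := by
    filter_upwards [hz'] with w hw using ((extChartAt I' (f y)).left_inv hw).symm
  refine (pullbackOneForm_comp hfz hsymm α).symm.trans ((pullbackOneForm_congr hcomp α).trans ?_)
  refine (pullbackOneForm_comp (f := writtenInExtChartAt I I' y f) hsymm' hg α).trans ?_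
  rw [pullbackOneForm, mfderiv_eq_fderiv]
  rfl

/-- The second derivatives of the coordinate expression of `f` cancel by symmetry. -/
theorem extDerivOneForm_pullbackOneForm [I.Boundaryless] [IsManifold I 2 N] [I'.Boundaryless]
    [IsManifold I' 2 N'] {f : N → N'} {y : N} (hf : ContMDiffAt I I' 2 f y)
    {α : ∀ y : N', TangentSpace I' y →L[ℝ] ℝ}
    (hα : DifferentiableAt ℝ (oneFormInChart I' α (f y)) (extChartAt I' (f y) (f y)))
    (U V : F) :
    extDerivOneForm I (pullbackOneForm I I' f α) y U V =
      extDerivOneForm I' α (f y) (mfderiv I I' f y U) (mfderiv I I' f y V) := by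
  set g := writtenInExtChartAt I I' y f with hg_def
  have hfd := hf.mdifferentiableAt two_ne_zero
  have hgy : g (extChartAt I y y) = extChartAt I' (f y) (f y) := by
    simp only [hg_def, writtenInExtChartAt, Function.comp_apply, extChartAt_to_inv]
  have hg : ContDiffAt ℝ 2 g (extChartAt I y y) := by
    rw [← contDiffWithinAt_univ, ← I.range_eq_univ]
    exact (contMDiffAt_iff.1 hf).2
  have hmf : (mfderiv I I' f y : F →L[ℝ] F') = fderiv ℝ g (extChartAt I y y) := by
    rw [hfd.mfderiv, I.range_eq_univ, fderivWithin_univ]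
  have hf' : ∀ᶠ w in 𝓝 y, MDifferentiableAt I I' f w :=
    ((contMDiffAt_iff_contMDiffAt_nhds (by simp)).1 hf).mono fun w hw =>
      hw.mdifferentiableAt two_ne_zero
  rw [← hgy] at hα
  have hD := (hα.hasFDerivAt.comp _ (hg.differentiableAt two_ne_zero).hasFDerivAt).clm_comp
    ((hg.fderiv_right (m := 1) (by norm_num)).differentiableAt one_ne_zero).hasFDerivAt
  have hsymm : IsSymmSndFDerivAt ℝ g (extChartAt I y y) := hg.isSymmSndFDerivAt (by simp)
  have hl := extDerivOneForm_eq I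
    (hD.congr_of_eventuallyEq (oneFormInChart_pullbackOneForm hf' α)) U V
  rw [hgy] at hα
  have hr := extDerivOneForm_eq I' hα.hasFDerivAt (fderiv ℝ g (extChartAt I y y) U)
    (fderiv ℝ g (extChartAt I y y) V)
  refine hl.trans (Eq.trans ?_ (hr.symm.trans ?_))
  · simp only [← hgy, add_apply, ContinuousLinearMap.comp_apply, Function.comp_apply,
      ContinuousLinearMap.compL_apply, ContinuousLinearMap.flip_apply, hsymm.eq V U]
    ring
  · rw [hmf]
    rfl

theorem extDerivOneForm_swap [I.Boundaryless] (α : ∀ y : N, TangentSpace I y →L[ℝ] ℝ) (y : N)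
    (U V : TangentSpace I y) :
    extDerivOneForm I α y V U = -extDerivOneForm I α y U V :=
  (neg_sub _ _).symm

theorem extDerivOneForm_smul_add_smul [I.Boundaryless] [IsManifold I 1 N]
    {α β : ∀ y : N, TangentSpace I y →L[ℝ] ℝ} {y : N}
    (hα : DifferentiableAt ℝ (oneFormInChart I α y) (extChartAt I y y))
    (hβ : DifferentiableAt ℝ (oneFormInChart I β y) (extChartAt I y y)) (a b : ℝ)
    (U V : F) :
    extDerivOneForm I (a • α + b • β) y U V =
      a * extDerivOneForm I α y U V + b * extDerivOneForm I β y U V := by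
  have h := extDerivOneForm_eq I (α := a • α + b • β)
    ((hα.hasFDerivAt.const_smul a).add (hβ.hasFDerivAt.const_smul b)) U V
  refine h.trans ?_
  rw [extDerivOneForm_eq I hα.hasFDerivAt U V, extDerivOneForm_eq I hβ.hasFDerivAt U V]
  simp only [add_apply, smul_apply, smul_eq_mul]
  ring

end Pullback

variable {E : Type*} [NormedAddCommGroup E] [NormedSpace ℝ E]
  {M : Type*} [TopologicalSpace M] [ChartedSpace E M] [IsManifold 𝓘(ℝ, E) ∞ M]

section Coordinates

/-- The linear isomorphism from the model space to the tangent space at `y` given by the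
preferred chart at `x₀`; a junk value if `y` is outside that chart. -/
def frame (x₀ y : M) : E →L[ℝ] TangentSpace 𝓘(ℝ, E) y :=
  (trivializationAt E (TangentSpace 𝓘(ℝ, E) : M → Type _) x₀).symmL ℝ y

/-- The inverse of `frame`: the components of a tangent vector in the preferred chart at `x₀`. -/
def coframe (x₀ y : M) : TangentSpace 𝓘(ℝ, E) y →L[ℝ] E :=
  (trivializationAt E (TangentSpace 𝓘(ℝ, E) : M → Type _) x₀).continuousLinearMapAt ℝ y

theorem frame_coframe {x₀ y : M} (hy : y ∈ (extChartAt 𝓘(ℝ, E) x₀).source)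
    (v : TangentSpace 𝓘(ℝ, E) y) : frame x₀ y (coframe x₀ y v) = v :=
  (trivializationAt E (TangentSpace 𝓘(ℝ, E) : M → Type _) x₀).symmL_continuousLinearMapAt
    (by simpa using hy) v

theorem coframe_frame {x₀ y : M} (hy : y ∈ (extChartAt 𝓘(ℝ, E) x₀).source) (v : E) :
    coframe x₀ y (frame x₀ y v) = v :=
  (trivializationAt E (TangentSpace 𝓘(ℝ, E) : M → Type _) x₀).continuousLinearMapAt_symmL
    (by simpa using hy) v

theorem coframe_self (x : M) (v : E) : coframe x x v = v := by
  rw [coframe, TangentBundle.continuousLinearMapAt_trivializationAt (mem_chart_source E x),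
    mfderiv_extChartAt_self]
  rfl

theorem frame_self (x : M) (v : E) : frame x x v = v := by
  have h := frame_coframe (mem_extChartAt_source x) (v : TangentSpace 𝓘(ℝ, E) x)
  rwa [coframe_self] at h

theorem mfderiv_extChartAt_symm_eq_frame (x₀ : M) {z : E}
    (hz : z ∈ (extChartAt 𝓘(ℝ, E) x₀).target) :
    (mfderiv 𝓘(ℝ, E) 𝓘(ℝ, E) (extChartAt 𝓘(ℝ, E) x₀).symm z : E →L[ℝ] _) =
      frame (E := E) x₀ ((extChartAt 𝓘(ℝ, E) x₀).symm z) := by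
  have hs : (extChartAt 𝓘(ℝ, E) x₀).symm z ∈ (chartAt E x₀).source := by
    simpa using (extChartAt 𝓘(ℝ, E) x₀).map_target hz
  rw [frame, TangentBundle.symmL_trivializationAt hs, (extChartAt 𝓘(ℝ, E) x₀).right_inv hz,
    ModelWithCorners.range_eq_univ, mfderivWithin_univ]

/-- The coordinate expression of the vector field `V` in the preferred chart at `x₀`. -/
def fieldInChart (x₀ : M) (V : ∀ y : M, TangentSpace 𝓘(ℝ, E) y) (z : E) : E :=
  coframe x₀ ((extChartAt 𝓘(ℝ, E) x₀).symm z) (V ((extChartAt 𝓘(ℝ, E) x₀).symm z))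

theorem fieldInChart_self (x : M) (V : ∀ y : M, TangentSpace 𝓘(ℝ, E) y) :
    fieldInChart (E := E) x V (extChartAt 𝓘(ℝ, E) x x) = V x := by
  unfold fieldInChart
  rw [extChartAt_to_inv]
  exact coframe_self (E := E) x (V x)

theorem mpullbackWithin_extChartAt_symm {x₀ : M} {z : E}
    (hz : z ∈ (extChartAt 𝓘(ℝ, E) x₀).target) (V : ∀ y : M, TangentSpace 𝓘(ℝ, E) y) :
    mpullbackWithin 𝓘(ℝ, E) 𝓘(ℝ, E) (extChartAt 𝓘(ℝ, E) x₀).symm V (range 𝓘(ℝ, E)) z =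
      fieldInChart (E := E) x₀ V z := by
  have hs := (extChartAt 𝓘(ℝ, E) x₀).map_target hz
  rw [mpullbackWithin_apply, ModelWithCorners.range_eq_univ, mfderivWithin_univ]
  rw [mfderiv_extChartAt_symm_eq_frame x₀ hz]
  exact congrArg (fun L : TangentSpace 𝓘(ℝ, E) ((extChartAt 𝓘(ℝ, E) x₀).symm z) →L[ℝ] E => L _)
    (ContinuousLinearMap.inverse_eq (ContinuousLinearMap.ext (frame_coframe (E := E) hs))
      (ContinuousLinearMap.ext (coframe_frame (E := E) hs)))

theorem differentiableAt_fieldInChart [CompleteSpace E] {x : M}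
    {V : ∀ y : M, TangentSpace 𝓘(ℝ, E) y} (hV : MDiffAt (T% V) x) :
    DifferentiableAt ℝ (fieldInChart x V) (extChartAt 𝓘(ℝ, E) x x) := by
  have h := hV.mdifferentiableWithinAt.differentiableWithinAt_mpullbackWithin_vectorField
    (s := univ)
  rw [preimage_univ, univ_inter] at h
  refine (h.differentiableAt (by simp)).congr_of_eventuallyEq ?_
  filter_upwards [extChartAt_target_mem_nhds x] with z hz
    using (mpullbackWithin_extChartAt_symm hz V).symm

/-- The flat connection of the preferred chart at `x`, applied to the vector field `V`:
`chartDeriv V x v = ∂_v V`. -/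
def chartDeriv (V : ∀ y : M, TangentSpace 𝓘(ℝ, E) y) (x : M) :
    TangentSpace 𝓘(ℝ, E) x →L[ℝ] TangentSpace 𝓘(ℝ, E) x :=
  (fderiv ℝ (fieldInChart x V) (extChartAt 𝓘(ℝ, E) x x) : E →L[ℝ] E)

theorem chartDeriv_neg (V : ∀ y : M, TangentSpace 𝓘(ℝ, E) y) (x : M) :
    chartDeriv (-V) x = -chartDeriv V x := by
  have h : fieldInChart x (-V) = -fieldInChart x V := funext fun z => map_neg (coframe x _) _
  exact (congrArg (fun f : E → E => fderiv ℝ f _) h).trans fderiv_neg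

theorem mlieBracket_eq_chartDeriv (V W : ∀ y : M, TangentSpace 𝓘(ℝ, E) y) (x : M) :
    mlieBracket 𝓘(ℝ, E) V W x = chartDeriv W x (V x) - chartDeriv V x (W x) := by
  have hpull (V : ∀ y : M, TangentSpace 𝓘(ℝ, E) y) :
      mpullbackWithin 𝓘(ℝ, E) 𝓘(ℝ, E) (extChartAt 𝓘(ℝ, E) x).symm V (range 𝓘(ℝ, E))
        =ᶠ[𝓝 (extChartAt 𝓘(ℝ, E) x x)] (fieldInChart x V : E → E) := by
    filter_upwards [extChartAt_target_mem_nhds x] with z hz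
      using mpullbackWithin_extChartAt_symm hz V
  have hset : (extChartAt 𝓘(ℝ, E) x).symm ⁻¹' univ ∩ range 𝓘(ℝ, E) = univ := by simp
  rw [← mlieBracketWithin_univ, mlieBracketWithin_apply, mfderiv_extChartAt_self, hset]
  suffices h : ∀ f g : E → E, f =ᶠ[𝓝 (extChartAt 𝓘(ℝ, E) x x)] fieldInChart x V →
      g =ᶠ[𝓝 (extChartAt 𝓘(ℝ, E) x x)] fieldInChart x W →
      (ContinuousLinearMap.id ℝ E).inverse
          (lieBracketWithin ℝ f g univ (extChartAt 𝓘(ℝ, E) x x)) =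
        chartDeriv W x (V x) - chartDeriv V x (W x) from
    h _ _ (hpull V) (hpull W)
  intro f g hf hg
  rw [lieBracketWithin_univ, ContinuousLinearMap.inverse_id, ContinuousLinearMap.id_apply,
    hf.lieBracket_vectorField_eq hg, lieBracket, fieldInChart_self, fieldInChart_self]
  rfl

namespace AlmostComplexStructure

variable (J : AlmostComplexStructure E M)

/-- The coordinate expression of `J` in the preferred chart at `x₀`. -/
def inChart (x₀ : M) (z : E) : E →L[ℝ] E :=
  (coframe x₀ ((extChartAt 𝓘(ℝ, E) x₀).symm z)).comp
    ((J ((extChartAt 𝓘(ℝ, E) x₀).symm z)).comp (frame x₀ ((extChartAt 𝓘(ℝ, E) x₀).symm z)))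

theorem inChart_self (x : M) (v : E) : J.inChart x (extChartAt 𝓘(ℝ, E) x x) v = J x v := by
  rw [inChart, extChartAt_to_inv]
  exact (coframe_self x _).trans (congrArg (J x) (frame_self x v))

theorem frame_inChart (x₀ : M) {z : E} (hz : z ∈ (extChartAt 𝓘(ℝ, E) x₀).target) (v : E) :
    frame x₀ ((extChartAt 𝓘(ℝ, E) x₀).symm z) (J.inChart x₀ z v) =
      J ((extChartAt 𝓘(ℝ, E) x₀).symm z) (frame x₀ ((extChartAt 𝓘(ℝ, E) x₀).symm z) v) :=
  frame_coframe ((extChartAt 𝓘(ℝ, E) x₀).map_target hz) _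

theorem fieldInChart_mulField (x₀ : M) (V : ∀ y : M, TangentSpace 𝓘(ℝ, E) y) {z : E}
    (hz : z ∈ (extChartAt 𝓘(ℝ, E) x₀).target) :
    fieldInChart x₀ (J.mulField V) z = J.inChart x₀ z (fieldInChart x₀ V z) := by
  have h := frame_coframe ((extChartAt 𝓘(ℝ, E) x₀).map_target hz)
    (V ((extChartAt 𝓘(ℝ, E) x₀).symm z))
  exact congrArg (fun v => coframe x₀ _ (J _ v)) h.symm

theorem contMDiffAt_inCoordinates (x₀ : M) :
    ContMDiffAt 𝓘(ℝ, E) 𝓘(ℝ, E →L[ℝ] E) ∞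
      (fun y => ((coframe x₀ y).comp ((J y).comp (frame x₀ y)) : E →L[ℝ] E)) x₀ :=
  ((contMDiffAt_hom_bundle _).1 (J.contMDiff_toFun x₀)).2

theorem contDiffAt_inChart (x₀ : M) :
    ContDiffAt ℝ ∞ (J.inChart x₀) (extChartAt 𝓘(ℝ, E) x₀ x₀) := by
  rw [← contMDiffAt_iff_contDiffAt]
  exact ContMDiffAt.comp (extChartAt 𝓘(ℝ, E) x₀ x₀)
    (g := fun y => ((coframe x₀ y).comp ((J y).comp (frame x₀ y)) : E →L[ℝ] E))
    (by rw [extChartAt_to_inv]; exact J.contMDiffAt_inCoordinates x₀)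
    ((contMDiffOn_extChartAt_symm x₀).contMDiffAt (extChartAt_target_mem_nhds x₀))

/-- The derivative of `J` in the preferred chart at `x`: `J.deriv x v w = (∂_v J) w`. -/
def deriv (x : M) :
    TangentSpace 𝓘(ℝ, E) x →L[ℝ] TangentSpace 𝓘(ℝ, E) x →L[ℝ] TangentSpace 𝓘(ℝ, E) x :=
  (fderiv ℝ (J.inChart x) (extChartAt 𝓘(ℝ, E) x x) : E →L[ℝ] E →L[ℝ] E)

theorem hasFDerivAt_inChart (x : M) :
    HasFDerivAt (J.inChart x) (J.deriv x : E →L[ℝ] E →L[ℝ] E) (extChartAt 𝓘(ℝ, E) x x) :=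
  ((J.contDiffAt_inChart x).differentiableAt (by simp)).hasFDerivAt

theorem chartDeriv_mulField [CompleteSpace E] {x : M} {V : ∀ y : M, TangentSpace 𝓘(ℝ, E) y}
    (hV : MDiffAt (T% V) x) (v : TangentSpace 𝓘(ℝ, E) x) :
    chartDeriv (J.mulField V) x v = J.deriv x v (V x) + J x (chartDeriv V x v) := by
  have hev : fieldInChart x (J.mulField V) =ᶠ[𝓝 (extChartAt 𝓘(ℝ, E) x x)]
      fun z => J.inChart x z (fieldInChart x V z) := by
    filter_upwards [extChartAt_target_mem_nhds x] with z hz using J.fieldInChart_mulField x V hz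
  have h := (J.hasFDerivAt_inChart x).clm_apply (differentiableAt_fieldInChart hV).hasFDerivAt
  refine (congrArg (fun L : E →L[ℝ] E => L v) (h.congr_of_eventuallyEq hev).fderiv).trans ?_
  rw [fieldInChart_self, add_comm]
  exact congrArg (J.deriv x v (V x) + ·) (J.inChart_self x _)

end AlmostComplexStructure

end Coordinates

section TorsionFree

/-- `D` differentiates vector fields at `x` as a torsion-free connection does, and `S` is the
tensor `DJ`. Both the partial derivatives in a chart and the connection `∇̃` have this
property. -/
structure IsTorsionFreeDerivativeAt (J : AlmostComplexStructure E M) (x : M)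
    (D : (∀ y : M, TangentSpace 𝓘(ℝ, E) y) → TangentSpace 𝓘(ℝ, E) x →L[ℝ] TangentSpace 𝓘(ℝ, E) x)
    (S : TangentSpace 𝓘(ℝ, E) x →L[ℝ] TangentSpace 𝓘(ℝ, E) x →L[ℝ] TangentSpace 𝓘(ℝ, E) x) :
    Prop where
  map_neg {Y : ∀ y : M, TangentSpace 𝓘(ℝ, E) y} (hY : MDiffAt (T% Y) x) : D (-Y) = -D Y
  mlieBracket_eq {X Y : ∀ y : M, TangentSpace 𝓘(ℝ, E) y} (hX : MDiffAt (T% X) x)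
    (hY : MDiffAt (T% Y) x) : mlieBracket 𝓘(ℝ, E) X Y x = D Y (X x) - D X (Y x)
  map_mulField {Y : ∀ y : M, TangentSpace 𝓘(ℝ, E) y} (hY : MDiffAt (T% Y) x)
    (v : TangentSpace 𝓘(ℝ, E) x) : D (J.mulField Y) v = S v (Y x) + J x (D Y v)

theorem AlmostComplexStructure.mulField_mulField (J : AlmostComplexStructure E M)
    (Y : ∀ y : M, TangentSpace 𝓘(ℝ, E) y) : J.mulField (J.mulField Y) = -Y :=
  funext fun y => J.sq_eq_neg y (Y y)

theorem exists_mdifferentiableAt_eq (x : M) (v : TangentSpace 𝓘(ℝ, E) x) :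
    ∃ V : ∀ y : M, TangentSpace 𝓘(ℝ, E) y, MDiffAt (T% V) x ∧ V x = v :=
  ⟨FiberBundle.extend E v, FiberBundle.mdifferentiableAt_extend 𝓘(ℝ, E) E v,
    FiberBundle.extend_apply_self E v⟩

theorem AlmostComplexStructure.isTorsionFreeDerivativeAt_chartDeriv [CompleteSpace E]
    (J : AlmostComplexStructure E M) (x : M) :
    IsTorsionFreeDerivativeAt J x (fun Y => chartDeriv Y x) (J.deriv x) where
  map_neg {Y} _ := chartDeriv_neg Y x
  mlieBracket_eq {X Y} _ _ := mlieBracket_eq_chartDeriv X Y x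
  map_mulField hY := J.chartDeriv_mulField hY

section Tensors

variable [FiniteDimensional ℝ E]

theorem nijenhuis_eq_nijenhuisAux (J : AlmostComplexStructure E M) {x : M}
    {X Y : ∀ y : M, TangentSpace 𝓘(ℝ, E) y} (hX : MDiffAt (T% X) x) (hY : MDiffAt (T% Y) x) :
    nijenhuis J x (X x) (Y x) = nijenhuisAux J X Y x :=
  TensorialAt.mkHom₂_apply (Φ := fun X Y => nijenhuisAux J X Y x)
    (fun Y _ => nijenhuisAux_tensorial_left J x Y)
    (fun X _ => nijenhuisAux_tensorial_right J x X) hX hY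

theorem nablaJ_apply (cov : CovariantDerivative 𝓘(ℝ, E) E (TangentSpace 𝓘(ℝ, E) : M → Type _))
    (J : AlmostComplexStructure E M) {x : M} {Y : ∀ y : M, TangentSpace 𝓘(ℝ, E) y}
    (hY : MDiffAt (T% Y) x) (v : TangentSpace 𝓘(ℝ, E) x) :
    nablaJ cov J x v (Y x) = cov (J.mulField Y) x v - J x (cov Y x v) :=
  congrArg (fun L : TangentSpace 𝓘(ℝ, E) x →L[ℝ] TangentSpace 𝓘(ℝ, E) x => L v)
    (TensorialAt.mkHom_apply (nablaJAux_tensorial cov J x) hY)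

theorem mlieBracket_eq_symmetrize
    (cov : CovariantDerivative 𝓘(ℝ, E) E (TangentSpace 𝓘(ℝ, E) : M → Type _)) {x : M}
    {X Y : ∀ y : M, TangentSpace 𝓘(ℝ, E) y} (hX : MDiffAt (T% X) x) (hY : MDiffAt (T% Y) x) :
    mlieBracket 𝓘(ℝ, E) X Y x = symmetrize cov Y x (X x) - symmetrize cov X x (Y x) := by
  have hsymm (V : ∀ y : M, TangentSpace 𝓘(ℝ, E) y) (v : TangentSpace 𝓘(ℝ, E) x) :
      symmetrize cov V x v = cov V x v + -((1 / 2 : ℝ) • cov.torsion x v (V x)) :=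
    rfl
  rw [hsymm, hsymm, cov.torsion_antisymm (Y x) (X x), cov.torsion_apply hX hY]
  module

theorem isTorsionFreeDerivativeAt_symmetrize
    (cov : CovariantDerivative 𝓘(ℝ, E) E (TangentSpace 𝓘(ℝ, E) : M → Type _))
    (J : AlmostComplexStructure E M) (x : M) :
    IsTorsionFreeDerivativeAt J x (fun Y => symmetrize cov Y x) (nablaJ (symmetrize cov) J x) where
  map_neg {Y} hY := by
    rw [← neg_one_smul ℝ Y, (symmetrize cov).isCovariantDerivativeOnUniv.smul_const (-1) hY,
      neg_one_smul]
  mlieBracket_eq := mlieBracket_eq_symmetrize cov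
  map_mulField hY v := by rw [nablaJ_apply _ J hY, sub_add_cancel]

end Tensors

namespace IsTorsionFreeDerivativeAt

variable {J : AlmostComplexStructure E M} {x : M}
  {D : (∀ y : M, TangentSpace 𝓘(ℝ, E) y) → TangentSpace 𝓘(ℝ, E) x →L[ℝ] TangentSpace 𝓘(ℝ, E) x}
  {S : TangentSpace 𝓘(ℝ, E) x →L[ℝ] TangentSpace 𝓘(ℝ, E) x →L[ℝ] TangentSpace 𝓘(ℝ, E) x}

theorem apply_mul_right (h : IsTorsionFreeDerivativeAt J x D S) (X Y : TangentSpace 𝓘(ℝ, E) x) :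
    S X (J x Y) = -J x (S X Y) := by
  obtain ⟨Y, hY, rfl⟩ := exists_mdifferentiableAt_eq x Y
  have hneg : D (-Y) X = -D Y X := by rw [h.map_neg hY]; rfl
  have hsq : D (J.mulField (J.mulField Y)) X = S X (J x (Y x)) + J x (D (J.mulField Y) X) :=
    h.map_mulField (J.mdifferentiableAt_mulField hY) X
  rw [J.mulField_mulField, hneg, h.map_mulField hY, map_add, J.sq_eq_neg] at hsq
  exact eq_neg_of_add_eq_zero_left (add_eq_right.1 ((add_assoc _ _ _).trans hsq.symm))

theorem nijenhuis_eq [FiniteDimensional ℝ E] (h : IsTorsionFreeDerivativeAt J x D S)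
    (X Y : TangentSpace 𝓘(ℝ, E) x) :
    nijenhuis J x X Y = S (J x X) Y - S (J x Y) X - J x (S X Y) + J x (S Y X) := by
  obtain ⟨X, hX, rfl⟩ := exists_mdifferentiableAt_eq x X
  obtain ⟨Y, hY, rfl⟩ := exists_mdifferentiableAt_eq x Y
  have hJX := J.mdifferentiableAt_mulField hX
  have hJY := J.mdifferentiableAt_mulField hY
  rw [nijenhuis_eq_nijenhuisAux J hX hY, nijenhuisAux, h.mlieBracket_eq hJX hJY,
    h.mlieBracket_eq hX hJY, h.mlieBracket_eq hJX hY, h.mlieBracket_eq hX hY,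
    h.map_mulField hX, h.map_mulField hX, h.map_mulField hY, h.map_mulField hY]
  simp only [AlmostComplexStructure.mulField, map_sub, map_add, J.sq_eq_neg]
  module

end IsTorsionFreeDerivativeAt

theorem nijenhuis_mul_right [FiniteDimensional ℝ E] (J : AlmostComplexStructure E M) (x : M)
    (X Y : TangentSpace 𝓘(ℝ, E) x) : nijenhuis J x X (J x Y) = -J x (nijenhuis J x X Y) := by
  have := FiniteDimensional.complete ℝ E
  have h := J.isTorsionFreeDerivativeAt_chartDeriv x
  simp only [h.nijenhuis_eq, h.apply_mul_right, map_add, map_sub, map_neg, neg_apply, J.sq_eq_neg]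
  module

theorem bracketNablaJ_commutator_sub_nijenhuis [FiniteDimensional ℝ E]
    (cov : CovariantDerivative 𝓘(ℝ, E) E (TangentSpace 𝓘(ℝ, E) : M → Type _))
    (J : AlmostComplexStructure E M) (x : M) (X Y : TangentSpace 𝓘(ℝ, E) x) :
    J x (bracketNablaJ (symmetrize cov) J x X Y) -
        bracketNablaJ (symmetrize cov) J x X (J x Y) - nijenhuis J x X Y =
      nablaJ (symmetrize cov) J x X (J x Y) - nablaJ (symmetrize cov) J x (J x X) Y := by
  have h := isTorsionFreeDerivativeAt_symmetrize cov J x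
  have hbracket (Y : TangentSpace 𝓘(ℝ, E) x) : bracketNablaJ (symmetrize cov) J x X Y =
      -nablaJ (symmetrize cov) J x X Y + nablaJ (symmetrize cov) J x Y X :=
    rfl
  rw [hbracket, hbracket, h.nijenhuis_eq, h.apply_mul_right, map_add, map_neg]
  module

theorem mulNijenhuis_commutator [FiniteDimensional ℝ E] (J : AlmostComplexStructure E M)
    (x : M) (X Y : TangentSpace 𝓘(ℝ, E) x) :
    J x (mulNijenhuis J x X Y) - mulNijenhuis J x X (J x Y) =
      (-2 : ℝ) • nijenhuis J x X Y := by
  have hmul (Y : TangentSpace 𝓘(ℝ, E) x) : mulNijenhuis J x X Y = J x (nijenhuis J x X Y) := rfl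
  rw [hmul, hmul, nijenhuis_mul_right, map_neg, J.sq_eq_neg]
  module

end TorsionFree

section Cotangent

theorem fst_mem_of_mem_extChartAt_target {ξ : CotangentBundle E M} {z : E × (E →L[ℝ] ℝ)}
    (hz : z ∈ (extChartAt (cotangentModel E) ξ).target) :
    z.1 ∈ (extChartAt 𝓘(ℝ, E) ξ.proj).target := by
  rw [FiberBundle.extChartAt_target] at hz
  exact hz.1.1

theorem proj_extChartAt_symm {ξ : CotangentBundle E M} {z : E × (E →L[ℝ] ℝ)}
    (hz : z ∈ (extChartAt (cotangentModel E) ξ).target) :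
    ((extChartAt (cotangentModel E) ξ).symm z).proj = (extChartAt 𝓘(ℝ, E) ξ.proj).symm z.1 := by
  rw [FiberBundle.extChartAt_target] at hz
  rw [FiberBundle.extChartAt]
  exact Trivialization.proj_symm_apply' (trivializationAt (E →L[ℝ] ℝ)
    (fun x : M => TangentSpace 𝓘(ℝ, E) x →L[ℝ] ℝ) ξ.proj) hz.1.2

theorem snd_trivializationAt (x₀ : M) (η : CotangentBundle E M) :
    (trivializationAt (E →L[ℝ] ℝ) (fun x : M => TangentSpace 𝓘(ℝ, E) x →L[ℝ] ℝ) x₀ η).2 =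
      η.snd.comp (frame x₀ η.proj) := by
  refine ContinuousLinearMap.ext fun v => ?_
  change ContinuousLinearMap.inCoordinates E (TangentSpace 𝓘(ℝ, E) : M → Type _) ℝ
    (fun _ : M => ℝ) x₀ η.proj x₀ η.proj η.snd v = _
  rw [ContinuousLinearMap.inCoordinates, ContinuousLinearMap.comp_apply,
    ContinuousLinearMap.comp_apply]
  exact congrArg (fun L : ℝ →ₗ[ℝ] ℝ => L _)
    (Bundle.Trivial.linearMapAt_trivialization ℝ M ℝ η.proj)

theorem extChartAt_cotangentBundle_self (ξ : CotangentBundle E M) :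
    extChartAt (cotangentModel E) ξ ξ = (extChartAt 𝓘(ℝ, E) ξ.proj ξ.proj, ξ.snd) := by
  rw [FiberBundle.extChartAt]
  exact Prod.ext rfl ((snd_trivializationAt ξ.proj ξ).trans
    (ContinuousLinearMap.ext fun v => congrArg ξ.snd (frame_self ξ.proj v)))

theorem dproj_mfderiv_extChartAt_symm (ξ : CotangentBundle E M) {z : E × (E →L[ℝ] ℝ)}
    (hz : z ∈ (extChartAt (cotangentModel E) ξ).target) (U : E × (E →L[ℝ] ℝ)) :
    dproj ((extChartAt (cotangentModel E) ξ).symm z)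
        (mfderiv 𝓘(ℝ, E × (E →L[ℝ] ℝ)) (cotangentModel E)
          (extChartAt (cotangentModel E) ξ).symm z U) =
      frame ξ.proj ((extChartAt (cotangentModel E) ξ).symm z).proj U.1 := by
  have hz₁ := fst_mem_of_mem_extChartAt_target hz
  have hcomp : (fun w => ((extChartAt (cotangentModel E) ξ).symm w).proj) =ᶠ[𝓝 z]
      (extChartAt 𝓘(ℝ, E) ξ.proj).symm ∘ Prod.fst := by
    filter_upwards [(isOpen_extChartAt_target ξ).mem_nhds hz] with w hw
      using proj_extChartAt_symm hw
  have hleft := (Bundle.mdifferentiableAt_proj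
    (fun x : M => TangentSpace 𝓘(ℝ, E) x →L[ℝ] ℝ)).hasMFDerivAt.comp z
    (mdifferentiableAt_extChartAt_symm hz).hasMFDerivAt
  have hright := (mdifferentiableAt_extChartAt_symm hz₁).hasMFDerivAt.comp z
    (hasFDerivAt_fst (𝕜 := ℝ) (E := E) (F := E →L[ℝ] ℝ)).hasMFDerivAt
  have hd := hasMFDerivAt_unique hleft (hright.congr_of_eventuallyEq hcomp)
  refine (congrArg (fun L : E × (E →L[ℝ] ℝ) →L[ℝ] E => L U) hd).trans ?_
  rw [proj_extChartAt_symm hz]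
  exact congrArg (fun L : E →L[ℝ] E => L U.1) (mfderiv_extChartAt_symm_eq_frame ξ.proj hz₁)

theorem dproj_apply (ξ : CotangentBundle E M) (U : E × (E →L[ℝ] ℝ)) : dproj ξ U = U.1 := by
  have h := dproj_mfderiv_extChartAt_symm ξ (mem_extChartAt_target ξ) U
  have hid := mfderivWithin_range_extChartAt_symm (I := cotangentModel E) (x := ξ)
  rw [ModelWithCorners.range_eq_univ, mfderivWithin_univ] at hid
  rw [extChartAt_to_inv] at h
  refine Eq.trans ?_ (h.trans (frame_self ξ.proj U.1))
  exact congrArg (dproj ξ)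
    (congrArg (fun L : E × (E →L[ℝ] ℝ) →L[ℝ] E × (E →L[ℝ] ℝ) => L U) hid).symm

theorem differentiableAt_oneFormInChart_liouville (ξ : CotangentBundle E M) :
    DifferentiableAt ℝ (oneFormInChart (cotangentModel E) (liouville E M) ξ)
      (extChartAt (cotangentModel E) ξ ξ) := by
  have hev : oneFormInChart (cotangentModel E) (liouville E M) ξ
      =ᶠ[𝓝 (extChartAt (cotangentModel E) ξ ξ)]
        fun z => z.2.comp (ContinuousLinearMap.fst ℝ E (E →L[ℝ] ℝ)) := by
    filter_upwards [extChartAt_target_mem_nhds ξ] with z hz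
      using ContinuousLinearMap.ext (oneFormInChart_liouville ξ hz)
  exact (differentiableAt_snd.clm_comp (differentiableAt_const _)).congr_of_eventuallyEq hev

theorem oneFormInChart_thetaJ (J : AlmostComplexStructure E M) (ξ : CotangentBundle E M)
    {z : E × (E →L[ℝ] ℝ)} (hz : z ∈ (extChartAt (cotangentModel E) ξ).target)
    (U : E × (E →L[ℝ] ℝ)) :
    oneFormInChart (cotangentModel E) (thetaJ J) ξ z U = z.2 (J.inChart ξ.proj z.1 U.1) := by
  have hU := dproj_mfderiv_extChartAt_symm ξ hz U
  have hJU := dproj_mfderiv_extChartAt_symm ξ hz (J.inChart ξ.proj z.1 U.1, 0)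
  refine Eq.trans ?_ (oneFormInChart_liouville ξ hz (J.inChart ξ.proj z.1 U.1, 0))
  refine congrArg ((extChartAt (cotangentModel E) ξ).symm z).snd ?_
  refine (congrArg (J _) hU).trans (Eq.trans ?_ hJU.symm)
  rw [proj_extChartAt_symm hz]
  exact (J.frame_inChart ξ.proj (fst_mem_of_mem_extChartAt_target hz) U.1).symm

theorem exists_hasFDerivAt_oneFormInChart_thetaJ (J : AlmostComplexStructure E M)
    (ξ : CotangentBundle E M) :
    ∃ D : E × (E →L[ℝ] ℝ) →L[ℝ] E × (E →L[ℝ] ℝ) →L[ℝ] ℝ,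
      HasFDerivAt (oneFormInChart (cotangentModel E) (thetaJ J) ξ) D
        (extChartAt (cotangentModel E) ξ ξ) ∧
      ∀ U V : E × (E →L[ℝ] ℝ),
        D U V = ξ.snd (J.deriv ξ.proj U.1 V.1) + U.2 (J ξ.proj V.1) := by
  have hev : oneFormInChart (cotangentModel E) (thetaJ J) ξ
      =ᶠ[𝓝 (extChartAt (cotangentModel E) ξ ξ)] fun z =>
        z.2.comp ((J.inChart ξ.proj z.1).comp (ContinuousLinearMap.fst ℝ E (E →L[ℝ] ℝ))) := by
    filter_upwards [extChartAt_target_mem_nhds ξ] with z hz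
      using ContinuousLinearMap.ext (oneFormInChart_thetaJ J ξ hz)
  have hJ : HasFDerivAt (J.inChart ξ.proj) (J.deriv ξ.proj : E →L[ℝ] E →L[ℝ] E)
      (extChartAt (cotangentModel E) ξ ξ).1 := by
    rw [extChartAt_cotangentBundle_self]
    exact J.hasFDerivAt_inChart ξ.proj
  have hD := (hasFDerivAt_snd (𝕜 := ℝ) (E := E) (F := E →L[ℝ] ℝ)).clm_comp
    ((hJ.comp _ hasFDerivAt_fst).clm_comp
      (hasFDerivAt_const (ContinuousLinearMap.fst ℝ E (E →L[ℝ] ℝ)) _))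
  rw [ContinuousLinearMap.comp_zero, zero_add] at hD
  refine ⟨_, hD.congr_of_eventuallyEq hev, fun U V => ?_⟩
  rw [extChartAt_cotangentBundle_self]
  exact congrArg (ξ.snd (J.deriv ξ.proj U.1 V.1) + ·) (congrArg U.2 (J.inChart_self ξ.proj V.1))

theorem differentiableAt_oneFormInChart_thetaJ (J : AlmostComplexStructure E M)
    (ξ : CotangentBundle E M) :
    DifferentiableAt ℝ (oneFormInChart (cotangentModel E) (thetaJ J) ξ)
      (extChartAt (cotangentModel E) ξ ξ) := by
  obtain ⟨D, hD, -⟩ := exists_hasFDerivAt_oneFormInChart_thetaJ J ξ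
  exact hD.differentiableAt

theorem extDerivOneForm_thetaJ_apply (J : AlmostComplexStructure E M) (ξ : CotangentBundle E M)
    (U V : E × (E →L[ℝ] ℝ)) :
    extDerivOneForm (cotangentModel E) (thetaJ J) ξ U V =
      (ξ.snd (J.deriv ξ.proj U.1 V.1) + U.2 (J ξ.proj V.1)) -
        (ξ.snd (J.deriv ξ.proj V.1 U.1) + V.2 (J ξ.proj U.1)) := by
  obtain ⟨D, hD, hD_apply⟩ := exists_hasFDerivAt_oneFormInChart_thetaJ J ξ
  refine (extDerivOneForm_eq (cotangentModel E) hD U V).trans ?_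
  rw [hD_apply, hD_apply]

theorem canonicalForm_add_left (ξ : CotangentBundle E M)
    (U U' V : TangentSpace (cotangentModel E) ξ) :
    canonicalForm E M ξ (U + U') V = canonicalForm E M ξ U V + canonicalForm E M ξ U' V :=
  congrArg (fun L : E × (E →L[ℝ] ℝ) →L[ℝ] ℝ => L V) (ContinuousLinearMap.map_add _ U U')

theorem canonicalForm_injective [FiniteDimensional ℝ E] (ξ : CotangentBundle E M) :
    Function.Injective (canonicalForm E M ξ) :=
  (canonicalForm_isInvertible ξ).injective

section Lifts

variable [FiniteDimensional ℝ E]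

theorem canonicalForm_contraction
    (R : ∀ x : M, TangentSpace 𝓘(ℝ, E) x →L[ℝ] TangentSpace 𝓘(ℝ, E) x →L[ℝ] TangentSpace 𝓘(ℝ, E) x)
    (ξ : CotangentBundle E M) (U V : TangentSpace (cotangentModel E) ξ) :
    canonicalForm E M ξ (contraction R ξ U) V = ξ.snd (R ξ.proj (dproj ξ U) (dproj ξ V)) :=
  canonicalForm_sharpForm (thetaTensor R) ξ U V

theorem canonicalForm_liftC (J : AlmostComplexStructure E M) (ξ : CotangentBundle E M)
    (U V : TangentSpace (cotangentModel E) ξ) :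
    canonicalForm E M ξ (liftC J ξ U) V = extDerivOneForm (cotangentModel E) (thetaJ J) ξ U V :=
  canonicalForm_sharpForm _ ξ U V

theorem canonicalForm_liftC_comm (J : AlmostComplexStructure E M) (ξ : CotangentBundle E M)
    (U V : TangentSpace (cotangentModel E) ξ) :
    canonicalForm E M ξ (liftC J ξ U) V = canonicalForm E M ξ U (liftC J ξ V) := by
  rw [canonicalForm_liftC, canonicalForm, extDerivOneForm_swap (liouville E M), ← canonicalForm,
    canonicalForm_liftC, extDerivOneForm_swap (thetaJ J) ξ U V, neg_neg]

theorem liftC_pairing (J : AlmostComplexStructure E M) (ξ : CotangentBundle E M)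
    (U V : E × (E →L[ℝ] ℝ)) :
    (liftC J ξ U : E × (E →L[ℝ] ℝ)).2 V.1 - V.2 (liftC J ξ U : E × (E →L[ℝ] ℝ)).1 =
      (ξ.snd (J.deriv ξ.proj U.1 V.1) + U.2 (J ξ.proj V.1)) -
        (ξ.snd (J.deriv ξ.proj V.1 U.1) + V.2 (J ξ.proj U.1)) :=
  (canonicalForm_apply ξ (liftC J ξ U) V).symm.trans
    ((canonicalForm_liftC J ξ U V).trans (extDerivOneForm_thetaJ_apply J ξ U V))

theorem fst_liftC (J : AlmostComplexStructure E M) (ξ : CotangentBundle E M)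
    (U : E × (E →L[ℝ] ℝ)) :
    (liftC J ξ U : E × (E →L[ℝ] ℝ)).1 = J ξ.proj U.1 := by
  refine (SeparatingDual.eq_iff_forall_dual_eq (R := ℝ)).2 fun f => ?_
  have h := liftC_pairing J ξ U (0, f)
  have hS : ξ.snd (J.deriv ξ.proj U.1 (0 : E)) = 0 :=
    (congrArg ξ.snd (map_zero (J.deriv ξ.proj U.1))).trans (map_zero ξ.snd)
  have hS' : ξ.snd (J.deriv ξ.proj (0 : E) U.1) = 0 :=
    (congrArg (fun L : E →L[ℝ] E => ξ.snd (L U.1)) (map_zero (J.deriv ξ.proj))).trans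
      (map_zero ξ.snd)
  have hJ : U.2 (J ξ.proj (0 : E)) = 0 :=
    (congrArg U.2 (map_zero (J ξ.proj))).trans (map_zero U.2)
  simp only [hS, hS', hJ, map_zero] at h
  linarith [h]

theorem snd_liftC (J : AlmostComplexStructure E M) (ξ : CotangentBundle E M)
    (U : E × (E →L[ℝ] ℝ)) (v : E) :
    (liftC J ξ U : E × (E →L[ℝ] ℝ)).2 v =
      U.2 (J ξ.proj v) + ξ.snd (J.deriv ξ.proj U.1 v - J.deriv ξ.proj v U.1) := by
  have h : (liftC J ξ U : E × (E →L[ℝ] ℝ)).2 v - 0 =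
      (ξ.snd (J.deriv ξ.proj U.1 v) + U.2 (J ξ.proj v)) - (ξ.snd (J.deriv ξ.proj v U.1) + 0) :=
    liftC_pairing J ξ U (v, 0)
  rw [map_sub]
  linarith

theorem dproj_liftC (J : AlmostComplexStructure E M) (ξ : CotangentBundle E M)
    (U : TangentSpace (cotangentModel E) ξ) :
    dproj ξ (liftC J ξ U) = J ξ.proj (dproj ξ U) :=
  (dproj_apply ξ _).trans ((fst_liftC J ξ U).trans (congrArg (J ξ.proj) (dproj_apply ξ U).symm))

theorem canonicalForm_liftC_liftC (J : AlmostComplexStructure E M) (ξ : CotangentBundle E M)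
    (U V : TangentSpace (cotangentModel E) ξ) :
    canonicalForm E M ξ (liftC J ξ (liftC J ξ U)) V =
      ξ.snd (nijenhuis J ξ.proj (dproj ξ U) (dproj ξ V)) - canonicalForm E M ξ U V := by
  have := FiniteDimensional.complete ℝ E
  have h := J.isTorsionFreeDerivativeAt_chartDeriv ξ.proj
  let X : TangentSpace 𝓘(ℝ, E) ξ.proj := (U : E × (E →L[ℝ] ℝ)).1
  let Y : TangentSpace 𝓘(ℝ, E) ξ.proj := (V : E × (E →L[ℝ] ℝ)).1
  let p : E →L[ℝ] ℝ := (U : E × (E →L[ℝ] ℝ)).2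
  let q : E →L[ℝ] ℝ := (V : E × (E →L[ℝ] ℝ)).2
  have hX : dproj ξ U = X := dproj_apply ξ U
  have hY : dproj ξ V = Y := dproj_apply ξ V
  have hω : canonicalForm E M ξ U V = p Y - q X := canonicalForm_apply ξ U V
  have hsq (f : E →L[ℝ] ℝ) (w : E) : f (J ξ.proj (J ξ.proj w)) = -f w :=
    (congrArg f (J.sq_eq_neg ξ.proj w)).trans (map_neg f w)
  have hfst : (liftC J ξ V : E × (E →L[ℝ] ℝ)).1 = J ξ.proj Y := fst_liftC J ξ V
  have hsnd : (liftC J ξ V : E × (E →L[ℝ] ℝ)).2 (J ξ.proj X) =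
      -q X + ξ.snd (J.deriv ξ.proj Y (J ξ.proj X) - J.deriv ξ.proj (J ξ.proj X) Y) :=
    (snd_liftC J ξ V (J ξ.proj X)).trans (congrArg (· + _) (hsq q X))
  have hθ : canonicalForm E M ξ (liftC J ξ U) (liftC J ξ V) =
      (ξ.snd (J.deriv ξ.proj X (J ξ.proj Y)) + p (J ξ.proj (J ξ.proj Y))) -
        (ξ.snd (J.deriv ξ.proj (J ξ.proj Y) X) +
          (liftC J ξ V : E × (E →L[ℝ] ℝ)).2 (J ξ.proj X)) := by
    rw [canonicalForm_liftC, ← hfst]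
    exact extDerivOneForm_thetaJ_apply J ξ U (liftC J ξ V)
  rw [canonicalForm_liftC_comm, hθ, hω, hX, hY, hsnd, hsq, h.nijenhuis_eq, h.apply_mul_right,
    h.apply_mul_right]
  simp only [map_add, map_sub, map_neg]
  ring

theorem contraction_smul (c : ℝ)
    (R : ∀ x : M, TangentSpace 𝓘(ℝ, E) x →L[ℝ] TangentSpace 𝓘(ℝ, E) x →L[ℝ] TangentSpace 𝓘(ℝ, E) x)
    (ξ : CotangentBundle E M) :
    contraction (fun x => c • R x) ξ = c • contraction R ξ := by
  refine ContinuousLinearMap.ext fun U => canonicalForm_injective ξ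
    (ContinuousLinearMap.ext fun V => ?_)
  refine (canonicalForm_contraction _ ξ U V).trans (((map_smul ξ.snd c _).trans
    (congrArg (c • ·) (canonicalForm_contraction R ξ U V).symm)).trans ?_)
  exact congrArg (fun L : E × (E →L[ℝ] ℝ) →L[ℝ] ℝ => L V)
    (ContinuousLinearMap.map_smul (canonicalForm E M ξ) c (contraction R ξ U)).symm

theorem completeLift_eq (J : AlmostComplexStructure E M) (ξ : CotangentBundle E M) :
    completeLift J ξ =
      liftC J ξ + contraction (fun x => (-(1 / 2) : ℝ) • mulNijenhuis J x) ξ := by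
  rw [completeLift, contraction_smul, neg_smul, sub_eq_add_neg]

end Lifts

end Cotangent

section FiberMul

variable (J : AlmostComplexStructure E M)

theorem fiberMul_fiberMul (a b c d : ℝ) (ξ : CotangentBundle E M) :
    fiberMul J a b (fiberMul J c d ξ) = fiberMul J (a * c - b * d) (a * d + b * c) ξ := by
  refine congrArg (Bundle.TotalSpace.mk ξ.proj)
    (ContinuousLinearMap.ext fun v : TangentSpace 𝓘(ℝ, E) ξ.proj => ?_)
  change a * (c * ξ.snd v + d * ξ.snd (J ξ.proj v)) +
      b * (c * ξ.snd (J ξ.proj v) + d * ξ.snd (J ξ.proj (J ξ.proj v))) =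
    (a * c - b * d) * ξ.snd v + (a * d + b * c) * ξ.snd (J ξ.proj v)
  rw [J.sq_eq_neg, map_neg]
  ring

theorem fiberMul_one_zero (ξ : CotangentBundle E M) : fiberMul J 1 0 ξ = ξ := by
  refine congrArg (Bundle.TotalSpace.mk ξ.proj) (ContinuousLinearMap.ext fun v => ?_)
  change 1 * ξ.snd v + 0 * ξ.snd (J ξ.proj v) = ξ.snd v
  ring

theorem exists_fiberMul_comp_eq_id {a b : ℝ} (hab : a ^ 2 + b ^ 2 ≠ 0) :
    ∃ c d : ℝ, fiberMul J a b ∘ fiberMul J c d = id ∧ fiberMul J c d ∘ fiberMul J a b = id := by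
  refine ⟨a / (a ^ 2 + b ^ 2), -b / (a ^ 2 + b ^ 2), funext fun ξ => ?_, funext fun ξ => ?_⟩ <;>
  · rw [Function.comp_apply, fiberMul_fiberMul]
    refine Eq.trans ?_ (fiberMul_one_zero J ξ)
    congr 1 <;> field_simp <;> ring

theorem snd_fiberMul_comp_frame (a b : ℝ) {x₀ : M} {η : CotangentBundle E M}
    (hη : η.proj ∈ (extChartAt 𝓘(ℝ, E) x₀).source) :
    ((fiberMul J a b η).snd.comp (frame x₀ η.proj) : E →L[ℝ] ℝ) =
      a • η.snd.comp (frame x₀ η.proj) + b • (η.snd.comp (frame x₀ η.proj)).comp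
        ((coframe x₀ η.proj).comp ((J η.proj).comp (frame x₀ η.proj))) :=
  ContinuousLinearMap.ext fun v =>
    congrArg (fun w => a * η.snd (frame x₀ η.proj v) + b * η.snd w)
      (frame_coframe hη (J η.proj (frame x₀ η.proj v))).symm

theorem contMDiff_fiberMul (a b : ℝ) :
    ContMDiff (cotangentModel E) (cotangentModel E) ∞ (fiberMul J a b) := by
  intro ξ
  have hproj : ContMDiff (cotangentModel E) 𝓘(ℝ, E) ∞ (fun η : CotangentBundle E M => η.proj) :=
    Bundle.contMDiff_proj (fun x : M => TangentSpace 𝓘(ℝ, E) x →L[ℝ] ℝ)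
  refine contMDiffAt_totalSpace.2 ⟨hproj ξ, ?_⟩
  have hid := contMDiffAt_id (I := cotangentModel E) (n := ∞) (x := ξ)
  have hsnd : ContMDiffAt (cotangentModel E) 𝓘(ℝ, E →L[ℝ] ℝ) ∞ (fun η : CotangentBundle E M =>
      (trivializationAt (E →L[ℝ] ℝ) (fun x : M => TangentSpace 𝓘(ℝ, E) x →L[ℝ] ℝ) ξ.proj η).2) ξ :=
    (contMDiffAt_totalSpace.1 hid).2
  have hJ := ContMDiffAt.comp ξ (J.contMDiffAt_inCoordinates ξ.proj) (hproj ξ)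
  have hsum := ((contMDiffAt_const (I := cotangentModel E) (I' := 𝓘(ℝ, ℝ)) (c := a)).smul hsnd).add
    ((contMDiffAt_const (I := cotangentModel E) (I' := 𝓘(ℝ, ℝ)) (c := b)).smul (hsnd.clm_comp hJ))
  refine hsum.congr_of_eventuallyEq ?_
  filter_upwards [(hproj ξ).continuousAt.eventually_mem
    (extChartAt_source_mem_nhds (I := 𝓘(ℝ, E)) ξ.proj)] with η hη
  refine (snd_trivializationAt ξ.proj (fiberMul J a b η)).trans
    ((snd_fiberMul_comp_frame J a b hη).trans ?_)
  exact congrArg (fun c : E →L[ℝ] ℝ => a • c + b • c.comp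
    ((coframe ξ.proj η.proj).comp ((J η.proj).comp (frame ξ.proj η.proj))))
    (snd_trivializationAt ξ.proj η).symm

theorem mdifferentiableAt_fiberMul (a b : ℝ) (ξ : CotangentBundle E M) :
    MDifferentiableAt (cotangentModel E) (cotangentModel E) (fiberMul J a b) ξ :=
  (contMDiff_fiberMul J a b).mdifferentiable (by simp) ξ

/-- The differential `d_ξ Z` of the fiberwise multiplication `Z` by `a + i b`. -/
def dfiberMul (a b : ℝ) (ξ : CotangentBundle E M) :
    TangentSpace (cotangentModel E) ξ →L[ℝ] TangentSpace (cotangentModel E) (fiberMul J a b ξ) :=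
  mfderiv (cotangentModel E) (cotangentModel E) (fiberMul J a b) ξ

theorem dfiberMul_surjective {a b : ℝ} (hab : a ^ 2 + b ^ 2 ≠ 0) (ξ : CotangentBundle E M) :
    Function.Surjective (dfiberMul J a b ξ) := by
  obtain ⟨c, d, hright, hleft⟩ := exists_fiberMul_comp_eq_id J hab
  obtain ⟨η, rfl⟩ : ∃ η, fiberMul J c d η = ξ := ⟨fiberMul J a b ξ, congrFun hleft ξ⟩
  have hcomp := mfderiv_comp η (mdifferentiableAt_fiberMul J a b (fiberMul J c d η))
    (mdifferentiableAt_fiberMul J c d η)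
  rw [hright, mfderiv_id] at hcomp
  exact fun V => ⟨dfiberMul J c d η V,
    (congrArg (fun L : E × (E →L[ℝ] ℝ) →L[ℝ] E × (E →L[ℝ] ℝ) => L V) hcomp).symm⟩

theorem dproj_dfiberMul (a b : ℝ) (ξ : CotangentBundle E M)
    (U : TangentSpace (cotangentModel E) ξ) :
    dproj (fiberMul J a b ξ) (dfiberMul J a b ξ U) = dproj ξ U :=
  (congrArg (fun L : E × (E →L[ℝ] ℝ) →L[ℝ] E => L U)
    (mfderiv_comp ξ (Bundle.mdifferentiableAt_proj (fun x : M => TangentSpace 𝓘(ℝ, E) x →L[ℝ] ℝ))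
      (mdifferentiableAt_fiberMul J a b ξ))).symm

theorem pullbackOneForm_fiberMul_liouville (a b : ℝ) :
    pullbackOneForm (cotangentModel E) (cotangentModel E) (fiberMul J a b) (liouville E M) =
      a • liouville E M + b • thetaJ J :=
  funext fun ξ => ContinuousLinearMap.ext fun U =>
    congrArg (fiberMul J a b ξ).snd (dproj_dfiberMul J a b ξ U)

theorem pullbackOneForm_fiberMul_thetaJ (a b : ℝ) :
    pullbackOneForm (cotangentModel E) (cotangentModel E) (fiberMul J a b) (thetaJ J) =
      a • thetaJ J + (-b) • liouville E M := by
  refine funext fun ξ => ContinuousLinearMap.ext fun U => ?_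
  refine (congrArg (fun v => (fiberMul J a b ξ).snd (J ξ.proj v))
    (dproj_dfiberMul J a b ξ U)).trans ?_
  change a * ξ.snd (J ξ.proj (dproj ξ U)) + b * ξ.snd (J ξ.proj (J ξ.proj (dproj ξ U))) =
    a * ξ.snd (J ξ.proj (dproj ξ U)) + -b * ξ.snd (dproj ξ U)
  rw [J.sq_eq_neg, map_neg]
  ring

variable [FiniteDimensional ℝ E]

theorem canonicalForm_dfiberMul (a b : ℝ) (ξ : CotangentBundle E M)
    (U V : TangentSpace (cotangentModel E) ξ) :
    canonicalForm E M (fiberMul J a b ξ) (dfiberMul J a b ξ U) (dfiberMul J a b ξ V) =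
      a * canonicalForm E M ξ U V + b * canonicalForm E M ξ (liftC J ξ U) V := by
  have h := extDerivOneForm_pullbackOneForm ((contMDiff_fiberMul J a b ξ).of_le ENat.LEInfty.out)
    (differentiableAt_oneFormInChart_liouville (fiberMul J a b ξ)) U V
  rw [pullbackOneForm_fiberMul_liouville] at h
  rw [canonicalForm_liftC]
  exact h.symm.trans (extDerivOneForm_smul_add_smul (differentiableAt_oneFormInChart_liouville ξ)
    (differentiableAt_oneFormInChart_thetaJ J ξ) a b U V)

theorem canonicalForm_liftC_dfiberMul (a b : ℝ) (ξ : CotangentBundle E M)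
    (U V : TangentSpace (cotangentModel E) ξ) :
    canonicalForm E M (fiberMul J a b ξ) (liftC J (fiberMul J a b ξ) (dfiberMul J a b ξ U))
        (dfiberMul J a b ξ V) =
      a * canonicalForm E M ξ (liftC J ξ U) V + -b * canonicalForm E M ξ U V := by
  have h := extDerivOneForm_pullbackOneForm ((contMDiff_fiberMul J a b ξ).of_le ENat.LEInfty.out)
    (differentiableAt_oneFormInChart_thetaJ J (fiberMul J a b ξ)) U V
  rw [pullbackOneForm_fiberMul_thetaJ] at h
  rw [canonicalForm_liftC, canonicalForm_liftC]
  exact h.symm.trans (extDerivOneForm_smul_add_smul (differentiableAt_oneFormInChart_thetaJ J ξ)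
    (differentiableAt_oneFormInChart_liouville ξ) a (-b) U V)

theorem canonicalForm_contraction_dfiberMul
    (R : ∀ x : M, TangentSpace 𝓘(ℝ, E) x →L[ℝ] TangentSpace 𝓘(ℝ, E) x →L[ℝ] TangentSpace 𝓘(ℝ, E) x)
    (a b : ℝ) (ξ : CotangentBundle E M) (U V : TangentSpace (cotangentModel E) ξ) :
    canonicalForm E M (fiberMul J a b ξ) (contraction R (fiberMul J a b ξ) (dfiberMul J a b ξ U))
        (dfiberMul J a b ξ V) =
      a * ξ.snd (R ξ.proj (dproj ξ U) (dproj ξ V)) +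
        b * ξ.snd (J ξ.proj (R ξ.proj (dproj ξ U) (dproj ξ V))) := by
  rw [canonicalForm_contraction, dproj_dfiberMul, dproj_dfiberMul]
  rfl

theorem canonicalForm_commutator_dfiberMul
    (R : ∀ x : M, TangentSpace 𝓘(ℝ, E) x →L[ℝ] TangentSpace 𝓘(ℝ, E) x →L[ℝ] TangentSpace 𝓘(ℝ, E) x)
    (a b : ℝ) (ξ : CotangentBundle E M) (U V : TangentSpace (cotangentModel E) ξ) :
    canonicalForm E M (fiberMul J a b ξ)
        ((liftC J (fiberMul J a b ξ) + contraction R (fiberMul J a b ξ)) (dfiberMul J a b ξ U))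
        (dfiberMul J a b ξ V) -
      canonicalForm E M (fiberMul J a b ξ)
        (dfiberMul J a b ξ ((liftC J ξ + contraction R ξ) U)) (dfiberMul J a b ξ V) =
      b * ξ.snd (J ξ.proj (R ξ.proj (dproj ξ U) (dproj ξ V)) -
        R ξ.proj (dproj ξ U) (J ξ.proj (dproj ξ V)) -
          nijenhuis J ξ.proj (dproj ξ U) (dproj ξ V)) := by
  have hleft := canonicalForm_add_left (fiberMul J a b ξ)
    (liftC J (fiberMul J a b ξ) (dfiberMul J a b ξ U))
    (contraction R (fiberMul J a b ξ) (dfiberMul J a b ξ U)) (dfiberMul J a b ξ V)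
  have hω := canonicalForm_add_left ξ (liftC J ξ U) (contraction R ξ U) V
  have hωJ : canonicalForm E M ξ (liftC J ξ (liftC J ξ U + contraction R ξ U)) V =
      canonicalForm E M ξ (liftC J ξ (liftC J ξ U)) V +
        ξ.snd (R ξ.proj (dproj ξ U) (J ξ.proj (dproj ξ V))) := by
    rw [canonicalForm_liftC_comm, canonicalForm_add_left, canonicalForm_contraction, dproj_liftC,
      canonicalForm_liftC_comm J ξ (liftC J ξ U)]
  refine (congrArg₂ (· - ·) hleft
    (canonicalForm_dfiberMul J a b ξ (liftC J ξ U + contraction R ξ U) V)).trans ?_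
  rw [hω, hωJ, canonicalForm_liftC_dfiberMul, canonicalForm_contraction_dfiberMul,
    canonicalForm_liftC_liftC, canonicalForm_contraction]
  simp only [map_sub]
  ring

theorem isHolomorphic_fiberMul_iff (a : ℝ) {b : ℝ} (hb : b ≠ 0)
    (R : ∀ x : M,
      TangentSpace 𝓘(ℝ, E) x →L[ℝ] TangentSpace 𝓘(ℝ, E) x →L[ℝ] TangentSpace 𝓘(ℝ, E) x) :
    IsHolomorphic (cotangentModel E) (cotangentModel E) (fun ξ => liftC J ξ + contraction R ξ)
        (fun ξ => liftC J ξ + contraction R ξ) (fiberMul J a b) ↔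
      ∀ (x : M) (X Y : TangentSpace 𝓘(ℝ, E) x),
        J x (R x X Y) - R x X (J x Y) = nijenhuis J x X Y := by
  have hab : a ^ 2 + b ^ 2 ≠ 0 := by positivity
  constructor
  · intro h x X Y
    refine sub_eq_zero.1 ((SeparatingDual.eq_zero_iff_forall_dual_eq_zero (R := ℝ) (V := E) _).2
      fun p => ?_)
    have hcomm := canonicalForm_commutator_dfiberMul J R a b ⟨x, p⟩
      ((X, 0) : E × (E →L[ℝ] ℝ)) ((Y, 0) : E × (E →L[ℝ] ℝ))
    have hZ := congrArg (fun L : E × (E →L[ℝ] ℝ) →L[ℝ] E × (E →L[ℝ] ℝ) => L (X, 0)) (h.2 ⟨x, p⟩)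
    have hX : dproj (⟨x, p⟩ : CotangentBundle E M) ((X, 0) : E × (E →L[ℝ] ℝ)) = X :=
      dproj_apply _ _
    have hY : dproj (⟨x, p⟩ : CotangentBundle E M) ((Y, 0) : E × (E →L[ℝ] ℝ)) = Y :=
      dproj_apply _ _
    rw [hX, hY] at hcomm
    refine (mul_eq_zero.1 (hcomm.symm.trans (sub_eq_zero.2 ?_))).resolve_left hb
    exact congrArg (fun W => canonicalForm E M (fiberMul J a b ⟨x, p⟩) W
      (dfiberMul J a b ⟨x, p⟩ ((Y, 0) : E × (E →L[ℝ] ℝ)))) hZ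
  · intro h
    refine ⟨contMDiff_fiberMul J a b, fun ξ => ContinuousLinearMap.ext fun U => ?_⟩
    refine canonicalForm_injective _ (ContinuousLinearMap.ext fun W => ?_)
    obtain ⟨V, rfl⟩ := dfiberMul_surjective J hab ξ W
    have hcomm := canonicalForm_commutator_dfiberMul J R a b ξ U V
    rw [h, sub_self, map_zero, mul_zero] at hcomm
    exact sub_eq_zero.1 hcomm

end FiberMul

end

end AlmostComplex

theorem corollary3 {E : Type*} [NormedAddCommGroup E] [NormedSpace ℝ E] [FiniteDimensional ℝ E]
    {M : Type*} [TopologicalSpace M] [ChartedSpace E M] [IsManifold 𝓘(ℝ, E) ∞ M]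
    (J : AlmostComplex.AlmostComplexStructure E M) (a b : ℝ) (hb : b ≠ 0) :
    AlmostComplex.IsHolomorphic (AlmostComplex.cotangentModel E) (AlmostComplex.cotangentModel E)
      (AlmostComplex.completeLift J) (AlmostComplex.completeLift J)
      (AlmostComplex.fiberMul J a b) ∧
    ∀ cov : CovariantDerivative 𝓘(ℝ, E) E (TangentSpace 𝓘(ℝ, E) : M → Type _),
      AlmostComplex.IsHolomorphic (AlmostComplex.cotangentModel E) (AlmostComplex.cotangentModel E)
        (AlmostComplex.horizontalLift cov J) (AlmostComplex.horizontalLift cov J)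
        (AlmostComplex.fiberMul J a b) ↔
      ∀ (x : M) (X Y : TangentSpace 𝓘(ℝ, E) x),
        AlmostComplex.nablaJ (AlmostComplex.symmetrize cov) J x (J x X) Y =
          AlmostComplex.nablaJ (AlmostComplex.symmetrize cov) J x X (J x Y) := by
  refine ⟨?_, fun cov => (AlmostComplex.isHolomorphic_fiberMul_iff J a hb _).trans
    (forall_congr' fun x => forall_congr' fun X => forall_congr' fun Y => ?_)⟩
  · rw [funext (AlmostComplex.completeLift_eq J)]
    refine (AlmostComplex.isHolomorphic_fiberMul_iff J a hb _).2 fun x X Y => ?_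
    change J x (-(1 / 2 : ℝ) • AlmostComplex.mulNijenhuis J x X Y) -
      -(1 / 2 : ℝ) • AlmostComplex.mulNijenhuis J x X (J x Y) = _
    rw [map_smul, ← smul_sub, AlmostComplex.mulNijenhuis_commutator]
    module
  · rw [← sub_eq_zero, AlmostComplex.bracketNablaJ_commutator_sub_nijenhuis, sub_eq_zero, eq_comm]
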